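/- Let $R_1,R_2,R\in\mathbb R$ with $R>R_1+R_2$, let $T>0$, and write $B_\rho=\{x\in\mathbb R^3:|x|<\rho\}$. Let $a\in C^1([0,\infty);\mathbb R^3)$ satisfy $|a(t)|<R_2$ for all $t\ge 0$, and let $g:[0,\infty)\to\mathbb R$ be continuous and bounded, and not identically zero on $[0,T]$. Let $\Omega\subset\mathbb R^3$ be a bounded domain (nonempty, open and connected) with $\Omega\cap(\mathbb R^3\setminus B_R)\neq\emptyset$. For $k=1,2$ let $f_k\in L^2(\mathbb R^3)$ be a real-valued function that vanishes almost everywhere outside $B_{R_1}$, and let $u_k\in L^2(0,T;H^2(\mathbb R^3))\cap H^1(0,T;L^2(\mathbb R^3))$, taken with its representative in $C([0,T];L^2(\mathbb R^3))$, be the solution of $$\partial_t u_k-\Delta u_k=f_k(x-a(t))\,g(t)\ \text{ a.e. in }\mathbb R^3\times(0,T),\qquad u_k(\cdot,0)=0 .$$ If $u_1(x,T)=u_2(x,T)$ for almost every $x\in\Omega$, then $f_1=f_2$ almost everywhere. In other words, when $a$ and $g$ are known, the source profile is uniquely determined by the final data $u(x,T)$, $x\in\Omega$; in particular $\Omega$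 may lie entirely away from $B_R$, a ball containing the support of the source at all times. -/

import Mathlib

open MeasureTheory Set
open scoped ContDiff

/-- Three-dimensional Euclidean space. -/
abbrev R3 : Type := EuclideanSpace ℝ (Fin 3)

/-- The real Hilbert space `L²(ℝ³)` of square-integrable functions modulo a.e. equality. -/
abbrev L2R3 : Type := Lp ℝ 2 (volume : Measure R3)

/-- `w` is the weak partial derivative `∂ᵢ v` on `ℝ³`:
`∫ v ∂ᵢφ = - ∫ w φ` for every test function `φ ∈ C_c^∞(ℝ³)`. -/
def HasWeakPartial (i : Fin 3) (v w : L2R3) : Prop :=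
  ∀ φ : R3 → ℝ, ContDiff ℝ ∞ φ → HasCompactSupport φ →
    ∫ x, v x * fderiv ℝ φ x (EuclideanSpace.single i (1 : ℝ)) = - ∫ x, w x * φ x

/-- `w ∈ L²(0, T; L²(ℝ³))`. -/
def MemL2L2 (T : ℝ) (w : ℝ → L2R3) : Prop :=
  MemLp w 2 (volume.restrict (Ioo 0 T))

/-- `u` belongs to `L²(0, T; H²(ℝ³))`, with first and second weak spatial derivatives
`Du i = ∂ᵢ u` and `D2u i j = ∂ⱼ ∂ᵢ u`. -/
structure IsL2H2With (T : ℝ) (u : ℝ → L2R3) (Du : Fin 3 → ℝ → L2R3)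
    (D2u : Fin 3 → Fin 3 → ℝ → L2R3) : Prop where
  mem : MemL2L2 T u
  mem_fst : ∀ i, MemL2L2 T (Du i)
  mem_snd : ∀ i j, MemL2L2 T (D2u i j)
  fst : ∀ᵐ t ∂(volume.restrict (Ioo 0 T)), ∀ i, HasWeakPartial i (u t) (Du i t)
  snd : ∀ᵐ t ∂(volume.restrict (Ioo 0 T)), ∀ i j, HasWeakPartial j (Du i t) (D2u i j t)

/-- `u` is the solution, in `L²(0, T; H²(ℝ³))`, of the Cauchy problem
`∂ₜ u - Δ u = F` in `ℝ³ × (0, T)`, `u(·, 0) = 0`.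

The curve `u` is the representative in `C([0, T]; L²(ℝ³))`, so that `u t` is the trace `u(·, t)`
for every `t ∈ [0, T]`. That `u` has the time derivative `ut ∈ L²(0, T; L²(ℝ³))` and the initial
value `0` is expressed by `u(t) = ∫₀ᵗ ut(s) ds` in `L²(ℝ³)`. -/
def IsHeatSolution (T : ℝ) (F : R3 → ℝ → ℝ) (u : ℝ → L2R3) : Prop :=
  ∃ (ut : ℝ → L2R3) (Du : Fin 3 → ℝ → L2R3) (D2u : Fin 3 → Fin 3 → ℝ → L2R3),
    IsL2H2With T u Du D2u ∧
    MemL2L2 T ut ∧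
    (∀ t ∈ Icc 0 T, u t = ∫ s in (0 : ℝ)..t, ut s) ∧
    ∀ᵐ t ∂(volume.restrict (Ioo 0 T)), ∀ᵐ x : R3, ut t x - ∑ i, D2u i i t x = F x t

/-- The moving source `F(x, t) = f(x - a(t)) g(t)` with profile `f`, orbit `a` and temporal
function `g`. -/
def movingSource (f : R3 → ℝ) (a : ℝ → R3) (g : ℝ → ℝ) (x : R3) (t : ℝ) : ℝ :=
  f (x - a t) * g t

/-- `f` is an admissible source profile: `f ∈ L²(ℝ³)` and `f` vanishes (a.e.) outside the ball
of radius `R₁` centred at the origin. -/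
def IsProfile (R₁ : ℝ) (f : R3 → ℝ) : Prop :=
  MemLp f 2 (volume : Measure R3) ∧ ∀ᵐ x : R3, x ∉ Metric.ball (0 : R3) R₁ → f x = 0

/-!
Let `f = f₁ - f₂` and `v = u₁ T - u₂ T`. By linearity `v` is the final temperature due to the source
`f (x - a t) g t`, and it vanishes on `Ω`.

*The final state as a potential.* Pairing the equation with the backward heat kernel
`k(T + δ - s, x - c)` expresses the Gaussian averages of `v` as space-time integrals of the source
against the heat kernel (`IsHeatSolution.integral_mul_heatKernel`). As `δ → 0`, outside the ball of
radius `ρ = R₁ + R₂`, which contains the source at all times, `v` is a superposition of heat kernels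
with poles in the ball (`ae_eq_sourcePotential`). On lines this potential is real-analytic, and the
exterior of the ball is connected, so a potential that vanishes on the part of `Ω` outside the ball
vanishes in the whole exterior (`sourcePotential_eq_zero`). Hence `v` has compact support.

*The transform.* Integrating the identity for `δ = 1` against `exp (-i z ⟪e, c⟫)`, with `e` a unit
vector and `z` complex, gives `V = F G` (`fourierLaplace_eq_integral`,
`integral_sourceMeasure_eq_mul`). Here `V` and `F` are the Fourier–Laplace transforms of `v` and `f`
in the direction `e`; both are of exponential type, since `v` and `f` have compact support. The third
function is
`G(z) = ∫_0^T exp(-t z² - i z ⟪e, a(T - t)⟫) g(T - t) dt`.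

*Growth.* If `F` is not identically zero, the quotient `G = V / F` of functions of exponential type
is of exponential type: the first main theorem of Nevanlinna theory bounds the circle averages of
`log⁺ ‖G‖` linearly in the radius, and subharmonicity turns this into a pointwise bound
(`IsExpType.of_mul`). But `G` contains the factors `exp(-t z²)`. Splitting the integral at `τ` shows
that the symbol `G_τ` of each segment `[τ, T]` is of exponential type as well; it is bounded on the
real axis, and on the imaginary axis it grows no faster than the exponential of the position of the
source at age `τ`, up to an arbitrarily small rate. The Phragmén–Lindelöf principle and Liouville's
theorem show that `G_τ` is an exponential times a constant, and the decay on the real axis makes the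
constant zero. In particular `G_τ(0) = ∫_τ^T g(T - t) dt = 0` for all `τ`, so `g = 0` on `[0, T]`
(`eq_zero_of_isExpType_sourceSymbol`), against the hypothesis.

So the Fourier transform of `f` vanishes in all directions, and `f = 0`.
-/

/-! ### Functions of exponential type and the Phragmén–Lindelöf principle -/

/-- An entire function is of exponential type when it grows at most like `exp (C ‖z‖)`. -/
def IsExpType (f : ℂ → ℂ) : Prop := ∃ A C : ℝ, ∀ z, ‖f z‖ ≤ A * Real.exp (C * ‖z‖)

lemma IsExpType.exists_nonneg {f : ℂ → ℂ} (hf : IsExpType f) :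
    ∃ A C : ℝ, 0 ≤ A ∧ 0 ≤ C ∧ ∀ z, ‖f z‖ ≤ A * Real.exp (C * ‖z‖) := by
  obtain ⟨A, C, h⟩ := hf
  refine ⟨|A|, |C|, abs_nonneg _, abs_nonneg _, fun z => (h z).trans ?_⟩
  gcongr
  · exact le_abs_self A
  · exact le_abs_self C

/-- The growth condition in the form in which the Phragmén–Lindelöf principle asks for it. -/
lemma isBigO_cobounded_of_expBound {f : ℂ → ℂ} {A C : ℝ} (h : ∀ z, ‖f z‖ ≤ A * Real.exp (C * ‖z‖))
    (s : Set ℂ) : ∃ c < (2 : ℝ), ∃ B,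
      f =O[Bornology.cobounded ℂ ⊓ Filter.principal s] fun z => Real.exp (B * ‖z‖ ^ c) := by
  refine ⟨1, by norm_num, C, Asymptotics.IsBigO.of_bound A (Filter.Eventually.of_forall fun z => ?_)⟩
  simpa using h z

/-- Phragmén–Lindelöf in the right half-plane: growth of type zero along the positive real axis is as
good as boundedness, since the factor `exp (-ε w)` is bounded by one on the imaginary axis. -/
lemma norm_le_of_right_half_plane {f : ℂ → ℂ} (hf : Differentiable ℂ f) (hexp : IsExpType f) {K : ℝ}
    (him : ∀ y : ℝ, ‖f (y * Complex.I)‖ ≤ K)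
    (hre : ∀ ε > 0, ∃ A, ∀ x : ℝ, 0 ≤ x → ‖f x‖ ≤ A * Real.exp (ε * x)) {z : ℂ} (hz : 0 ≤ z.re) :
    ‖f z‖ ≤ K := by
  obtain ⟨A, C, hA, hC, h⟩ := hexp.exists_nonneg
  -- the factor `exp (-ε w)` absorbs the growth on the real axis, and then `ε` tends to zero
  have key : ∀ ε > 0, ‖f z‖ * Real.exp (-ε * z.re) ≤ K := by
    intro ε hε
    have hb : ∀ w : ℂ, ‖f w * Complex.exp (-ε * w)‖ = ‖f w‖ * Real.exp (-ε * w.re) := by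
      intro w
      rw [norm_mul, Complex.norm_exp]
      simp
    have := PhragmenLindelof.right_half_plane_of_bounded_on_real (C := K)
      (f := fun w => f w * Complex.exp (-ε * w)) (z := z) ?_ ?_ ?_ ?_ hz
    · rwa [hb] at this
    · exact Differentiable.diffContOnCl (by fun_prop)
    · refine isBigO_cobounded_of_expBound (A := A) (C := C + ε) (fun w => ?_) _
      rw [hb, add_mul, Real.exp_add, ← mul_assoc]
      refine mul_le_mul (h w) (Real.exp_le_exp.2 ?_) (Real.exp_pos _).le (by positivity)
      have := Complex.abs_re_le_norm w
      have := neg_abs_le w.re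
      nlinarith
    · obtain ⟨A', hA'⟩ := hre ε hε
      refine Filter.isBoundedUnder_of_eventually_le (a := A') ?_
      filter_upwards [Filter.eventually_ge_atTop 0] with x hx
      rw [hb]
      calc ‖f x‖ * Real.exp (-ε * (x : ℂ).re) ≤ A' * Real.exp (ε * x) * Real.exp (-ε * x) := by
            rw [Complex.ofReal_re]
            exact mul_le_mul_of_nonneg_right (hA' x hx) (Real.exp_pos _).le
        _ = A' := by rw [mul_assoc, ← Real.exp_add]; simp
    · intro y
      rw [hb]
      simpa using him y
  have hlim : Filter.Tendsto (fun ε : ℝ => ‖f z‖ * Real.exp (-ε * z.re)) (nhdsWithin 0 (Ioi 0))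
      (nhds ‖f z‖) := by
    refine tendsto_nhdsWithin_of_tendsto_nhds ?_
    have : Continuous (fun ε : ℝ => ‖f z‖ * Real.exp (-ε * z.re)) := by fun_prop
    simpa using this.tendsto 0
  exact le_of_tendsto hlim (by filter_upwards [self_mem_nhdsWithin] with ε hε using key ε hε)

/-- Phragmén–Lindelöf in both half-planes. -/
lemma norm_le_of_bounded_on_imaginary_axis {f : ℂ → ℂ} (hf : Differentiable ℂ f) (hexp : IsExpType f)
    {K : ℝ} (him : ∀ y : ℝ, ‖f (y * Complex.I)‖ ≤ K)
    (hre : ∀ ε > 0, ∃ A, ∀ x : ℝ, ‖f x‖ ≤ A * Real.exp (ε * |x|)) (z : ℂ) : ‖f z‖ ≤ K := by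
  rcases le_total 0 z.re with hz | hz
  · refine norm_le_of_right_half_plane hf hexp him (fun ε hε => ?_) hz
    obtain ⟨A, hA⟩ := hre ε hε
    exact ⟨A, fun x hx => by simpa [abs_of_nonneg hx] using hA x⟩
  · have := norm_le_of_right_half_plane (f := fun w => f (-w)) (K := K) (z := -z) (by fun_prop) ?_ ?_ ?_
      (by simpa using hz)
    · simpa using this
    · obtain ⟨A, C, h⟩ := hexp
      exact ⟨A, C, fun w => by simpa using h (-w)⟩
    · intro y
      simpa using him (-y)
    · intro ε hε
      obtain ⟨A, hA⟩ := hre ε hε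
      exact ⟨A, fun x hx => by simpa [abs_of_nonneg hx] using hA (-x)⟩

/-- An integral of holomorphic functions that are dominated by one integrable function is
holomorphic: Cauchy's estimate dominates the derivatives. -/
theorem differentiableOn_integral_of_dominated {α : Type*} [MeasurableSpace α] {μ : Measure α}
    {F : ℂ → α → ℂ} {D : Set ℂ} (hD : IsOpen D) {bound : α → ℝ} (hb : Integrable bound μ)
    (hmeas : ∀ z ∈ D, AEStronglyMeasurable (F z) μ)
    (hdiff : ∀ᵐ x ∂μ, DifferentiableOn ℂ (fun z => F z x) D)
    (hbound : ∀ᵐ x ∂μ, ∀ z ∈ D, ‖F z x‖ ≤ bound x) :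
    DifferentiableOn ℂ (fun z => ∫ x, F z x ∂μ) D := by
  intro z₀ hz₀
  obtain ⟨r, hr, hrD⟩ := Metric.isOpen_iff.1 hD z₀ hz₀
  have hsub : ∀ z ∈ Metric.ball z₀ (r / 2), Metric.closedBall z (r / 2 / 2) ⊆ D := by
    intro z hz w hw
    apply hrD
    rw [Metric.mem_ball] at hz ⊢
    rw [Metric.mem_closedBall] at hw
    have := dist_triangle w z z₀
    linarith
  have hmem : ∀ z ∈ Metric.ball z₀ (r / 2), z ∈ D := fun z hz =>
    hsub z hz (Metric.mem_closedBall_self (by positivity))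
  have hz₀' : z₀ ∈ Metric.ball z₀ (r / 2) := Metric.mem_ball_self (by positivity)
  have hderiv : ∀ᵐ x ∂μ, ∀ z ∈ Metric.ball z₀ (r / 2),
      HasDerivAt (fun z => F z x) (deriv (fun z => F z x) z) z := by
    filter_upwards [hdiff] with x hx z hz
    exact (hx.differentiableAt (hD.mem_nhds (hmem z hz))).hasDerivAt
  refine (hasDerivAt_integral_of_dominated_loc_of_deriv_le (F := F) (μ := μ)
    (F' := fun z x => deriv (fun z => F z x) z)
    (bound := fun x => bound x / (r / 2 / 2)) (s := Metric.ball z₀ (r / 2))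
    (Metric.ball_mem_nhds _ (by positivity)) ?_ ?_ ?_ ?_ (hb.div_const _) hderiv).2.differentiableAt
    |>.differentiableWithinAt
  · filter_upwards [Metric.ball_mem_nhds z₀ (half_pos hr)] with z hz using hmeas z (hmem z hz)
  · exact hb.mono' (hmeas z₀ hz₀) (hbound.mono fun x hx => hx z₀ hz₀)
  · -- the derivative is the limit of measurable difference quotients
    obtain ⟨u, hu, hu_ne, hu_lim⟩ : ∃ u : ℕ → ℂ, (∀ n, z₀ + u n ∈ D) ∧ (∀ n, u n ≠ 0) ∧
        Filter.Tendsto u Filter.atTop (nhds 0) := by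
      refine ⟨fun n => ((r / 2 * (1 / ((n : ℝ) + 1)) : ℝ) : ℂ), fun n => ?_, fun n => ?_, ?_⟩
      · apply hrD
        rw [Metric.mem_ball, dist_eq_norm, add_sub_cancel_left, Complex.norm_real, Real.norm_eq_abs,
          abs_of_pos (by positivity)]
        have : 1 / ((n : ℝ) + 1) ≤ 1 := by
          rw [div_le_one (by positivity)]; linarith [n.cast_nonneg (α := ℝ)]
        nlinarith
      · have : (r / 2 * (1 / ((n : ℝ) + 1)) : ℝ) ≠ 0 := by positivity
        exact Complex.ofReal_ne_zero.2 this
      · have := (tendsto_one_div_add_atTop_nhds_zero_nat (𝕜 := ℝ)).const_mul (r / 2)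
        rw [mul_zero] at this
        exact ((Complex.continuous_ofReal.tendsto' 0 0 (by simp)).comp this)
    refine aestronglyMeasurable_of_tendsto_ae Filter.atTop
      (f := fun n x => (u n)⁻¹ • (F (z₀ + u n) x - F z₀ x)) (fun n => ?_) ?_
    · exact AEStronglyMeasurable.const_smul ((hmeas _ (hu n)).sub (hmeas _ hz₀)) (u n)⁻¹
    · filter_upwards [hderiv] with x hx
      have := (hx z₀ hz₀').tendsto_slope_zero
      exact this.comp (tendsto_nhdsWithin_iff.2 ⟨hu_lim, Filter.Eventually.of_forall hu_ne⟩)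
  · filter_upwards [hdiff, hbound] with x hx hxb z hz
    refine Complex.norm_deriv_le_of_forall_mem_sphere_norm_le (by positivity) ?_ fun w hw =>
      hxb w (hsub z hz (Metric.sphere_subset_closedBall hw))
    refine DifferentiableOn.diffContOnCl_ball (U := D) hx (hsub z hz)

/-! ### The symbol of a moving point source -/

/-- The integral `∫_τ^T exp(-(t - τ) z² - i z b(t)) h(t) dt`. For `τ = 0` it is the Fourier transform
of the temperature on the line due to a moving point source, where `t` is the age of the heat issued
and `h t`, `b t` are the strength and the position of the source when it was issued. For general `τ`
it takes into account the ages in `[τ, T]` only, diminished by `τ`. -/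
noncomputable def sourceSymbol (h b : ℝ → ℝ) (T τ : ℝ) (z : ℂ) : ℂ :=
  ∫ t in τ..T, Complex.exp (-((t - τ : ℝ) : ℂ) * z ^ 2 - Complex.I * z * (b t : ℂ)) * (h t : ℂ)

section PointSource

variable {h b : ℝ → ℝ}

lemma norm_exp_sourceSymbol (s β : ℝ) (z : ℂ) :
    ‖Complex.exp (-(s : ℂ) * z ^ 2 - Complex.I * z * (β : ℂ))‖ =
      Real.exp (-s * (z ^ 2).re + β * z.im) := by
  rw [Complex.norm_exp]
  congr 1
  rw [Complex.sub_re, Complex.re_mul_ofReal, Complex.I_mul_re, ← Complex.ofReal_neg,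
    Complex.re_ofReal_mul]
  ring

lemma intervalIntegrable_sourceSymbol (hh : Continuous h) (hb : Continuous b) (τ s t : ℝ) (z : ℂ) :
    IntervalIntegrable (fun t => Complex.exp (-((t - τ : ℝ) : ℂ) * z ^ 2 -
      Complex.I * z * (b t : ℂ)) * (h t : ℂ)) volume s t := by
  apply Continuous.intervalIntegrable
  fun_prop

/-- Splitting the time interval. -/
lemma sourceSymbol_split (hh : Continuous h) (hb : Continuous b) (T σ τ : ℝ) (z : ℂ) :
    sourceSymbol h b T σ z = sourceSymbol h b τ σ z +
      Complex.exp (-((τ - σ : ℝ) : ℂ) * z ^ 2) * sourceSymbol h b T τ z := by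
  unfold sourceSymbol
  rw [← intervalIntegral.integral_add_adjacent_intervals
    (intervalIntegrable_sourceSymbol hh hb σ σ τ z) (intervalIntegrable_sourceSymbol hh hb σ τ T z),
    ← intervalIntegral.integral_const_mul]
  congr 1
  apply intervalIntegral.integral_congr
  intro t _
  simp only
  rw [← mul_assoc, ← Complex.exp_add]
  congr 2
  push_cast
  ring

lemma differentiable_sourceSymbol (hh : Continuous h) (hb : Continuous b) {T τ : ℝ} (hτ : τ ≤ T) :
    Differentiable ℂ (sourceSymbol h b T τ) := by
  intro z₀
  have hK : IsCompact (Metric.closedBall z₀ 1 ×ˢ Icc τ T) :=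
    (isCompact_closedBall _ _).prod isCompact_Icc
  obtain ⟨C, hC⟩ := hK.exists_bound_of_continuousOn (f := fun p : ℂ × ℝ =>
    Complex.exp (-((p.2 - τ : ℝ) : ℂ) * p.1 ^ 2 - Complex.I * p.1 * (b p.2 : ℂ)) * (h p.2 : ℂ))
    (by fun_prop)
  have := differentiableOn_integral_of_dominated (μ := volume.restrict (Ioc τ T))
    (D := Metric.ball z₀ 1) (bound := fun _ => C) (F := fun z t =>
      Complex.exp (-((t - τ : ℝ) : ℂ) * z ^ 2 - Complex.I * z * (b t : ℂ)) * (h t : ℂ))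
    Metric.isOpen_ball (integrable_const _) (fun z _ => ?_) (Filter.Eventually.of_forall fun t => ?_) ?_
  · have h2 := this.differentiableAt (Metric.ball_mem_nhds z₀ one_pos)
    unfold sourceSymbol
    simp only [intervalIntegral.integral_of_le hτ]
    exact h2
  · exact Continuous.aestronglyMeasurable (by fun_prop)
  · fun_prop
  · filter_upwards [ae_restrict_mem measurableSet_Ioc] with t ht z hz
    exact hC (z, t) ⟨Metric.ball_subset_closedBall hz, Ioc_subset_Icc_self ht⟩

variable {T H B : ℝ}

/-- The trivial bound: `M` bounds the real part of the exponent. -/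
lemma norm_sourceSymbol_le {τ T' M : ℝ} (hτ : τ ≤ T') {z : ℂ} (hH : ∀ t ∈ Icc τ T', |h t| ≤ H)
    (hM : ∀ t ∈ Icc τ T', -(t - τ) * (z ^ 2).re + b t * z.im ≤ M) :
    ‖sourceSymbol h b T' τ z‖ ≤ Real.exp M * H * (T' - τ) := by
  unfold sourceSymbol
  rw [← abs_of_nonneg (sub_nonneg.2 hτ)]
  refine intervalIntegral.norm_integral_le_of_norm_le_const fun t ht => ?_
  rw [uIoc_of_le hτ] at ht
  have ht' := Ioc_subset_Icc_self ht
  rw [norm_mul, norm_exp_sourceSymbol, Complex.norm_real]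
  exact mul_le_mul (Real.exp_le_exp.2 (hM t ht')) (hH t ht') (norm_nonneg _) (Real.exp_pos _).le

/-- If the whole symbol has exponential type, then so do the symbols of all the final time segments:
for `Re z² ≥ 0` the integrand is of exponential type, and for `Re z² ≤ 0` the initial segment is. -/
lemma IsExpType.sourceSymbol_of_zero (hh : Continuous h) (hb : Continuous b)
    (hH : ∀ t ∈ Icc 0 T, |h t| ≤ H) (hB : ∀ t ∈ Icc 0 T, |b t| ≤ B)
    (hG : IsExpType (sourceSymbol h b T 0)) {τ : ℝ} (hτ : τ ∈ Icc 0 T) :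
    IsExpType (sourceSymbol h b T τ) := by
  obtain ⟨A, C, hA, hC, hAC⟩ := hG.exists_nonneg
  have hH0 : 0 ≤ H := (abs_nonneg _).trans (hH τ hτ)
  have hB0 : 0 ≤ B := (abs_nonneg _).trans (hB τ hτ)
  have hT0 : 0 ≤ T := hτ.1.trans hτ.2
  have hbz : ∀ t ∈ Icc 0 T, ∀ z : ℂ, b t * z.im ≤ B * ‖z‖ := fun t ht z => by
    calc b t * z.im ≤ |b t * z.im| := le_abs_self _
      _ = |b t| * |z.im| := abs_mul _ _
      _ ≤ B * ‖z‖ := mul_le_mul (hB t ht) (Complex.abs_im_le_norm z) (abs_nonneg _) hB0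
  refine ⟨A + H * T, B + C, fun z => ?_⟩
  have hz := norm_nonneg z
  have e1 : Real.exp (B * ‖z‖) ≤ Real.exp ((B + C) * ‖z‖) := Real.exp_le_exp.2 (by nlinarith)
  have e2 : Real.exp (C * ‖z‖) ≤ Real.exp ((B + C) * ‖z‖) := Real.exp_le_exp.2 (by nlinarith)
  rcases le_total 0 (z ^ 2).re with hz2 | hz2
  · have := norm_sourceSymbol_le (h := h) (b := b) (M := B * ‖z‖) (H := H) hτ.2 (z := z)
      (fun t ht => hH t ⟨hτ.1.trans ht.1, ht.2⟩) (fun t ht => by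
        have := hbz t ⟨hτ.1.trans ht.1, ht.2⟩ z
        have := mul_nonneg (sub_nonneg.2 ht.1) hz2
        linarith)
    calc _ ≤ _ := this
      _ ≤ Real.exp ((B + C) * ‖z‖) * H * T := by
        have := hτ.1
        have : 0 ≤ T - τ := sub_nonneg.2 hτ.2
        gcongr
        linarith
      _ ≤ _ := by nlinarith [mul_nonneg hA (Real.exp_pos ((B + C) * ‖z‖)).le]
  · have hsplit := sourceSymbol_split hh hb T 0 τ z
    have hinit : ‖Complex.exp ((τ : ℂ) * z ^ 2) * sourceSymbol h b τ 0 z‖ ≤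
        Real.exp (B * ‖z‖) * H * T := by
      have := norm_sourceSymbol_le (h := h) (b := b) (M := B * ‖z‖ - τ * (z ^ 2).re) (H := H) hτ.1
        (z := z) (fun t ht => hH t ⟨ht.1, ht.2.trans hτ.2⟩) (fun t ht => by
        have := hbz t ⟨ht.1, ht.2.trans hτ.2⟩ z
        have := mul_nonneg_of_nonpos_of_nonpos (sub_nonpos.2 ht.2) hz2
        linarith)
      rw [norm_mul, Complex.norm_exp, Complex.re_ofReal_mul]
      calc _ ≤ Real.exp (τ * (z ^ 2).re) * (Real.exp (B * ‖z‖ - τ * (z ^ 2).re) * H * (τ - 0)) := by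
            gcongr
        _ = Real.exp (B * ‖z‖) * H * τ := by
            rw [← mul_assoc, ← mul_assoc, ← Real.exp_add]; ring_nf
        _ ≤ _ := by gcongr; exact hτ.2
    have hG0 : ‖Complex.exp ((τ : ℂ) * z ^ 2) * sourceSymbol h b T 0 z‖ ≤ A * Real.exp (C * ‖z‖) := by
      rw [norm_mul, Complex.norm_exp, Complex.re_ofReal_mul]
      calc _ ≤ 1 * (A * Real.exp (C * ‖z‖)) := by
            gcongr
            · exact Real.exp_le_one_iff.2 (mul_nonpos_of_nonneg_of_nonpos hτ.1 hz2)
            · exact hAC z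
        _ = _ := one_mul _
    have heq : sourceSymbol h b T τ z = Complex.exp ((τ : ℂ) * z ^ 2) * sourceSymbol h b T 0 z -
        Complex.exp ((τ : ℂ) * z ^ 2) * sourceSymbol h b τ 0 z := by
      rw [hsplit, mul_add, ← mul_assoc, ← Complex.exp_add]
      simp
    rw [heq]
    calc _ ≤ A * Real.exp (C * ‖z‖) + Real.exp (B * ‖z‖) * H * T :=
          (norm_sub_le _ _).trans (add_le_add hG0 hinit)
      _ ≤ A * Real.exp ((B + C) * ‖z‖) + Real.exp ((B + C) * ‖z‖) * H * T := by gcongr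
      _ = _ := by ring

/-- On the imaginary axis the symbol grows, up to an arbitrarily small rate, no faster than the
exponential of the position of the source at age `τ`: the symbol of the slightly longer segment
`[τ - δ, T]` enters with the factor `exp(-δ y²)`, and on `[τ - δ, τ]` the position is nearly `b τ`. -/
lemma norm_sourceSymbol_imag_le (hh : Continuous h) (hb : Continuous b)
    (hH : ∀ t ∈ Icc 0 T, |h t| ≤ H) (hG : IsExpType (sourceSymbol h b T 0))
    (hB : ∀ t ∈ Icc 0 T, |b t| ≤ B) {τ : ℝ} (hτ : τ ∈ Ioo 0 T) {ε : ℝ} (hε : 0 < ε) :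
    ∃ A, ∀ y : ℝ, ‖sourceSymbol h b T τ (y * Complex.I)‖ * Real.exp (-(b τ * y)) ≤
      A * Real.exp (ε * |y|) := by
  obtain ⟨δ₀, hδ₀, hδb⟩ := Metric.continuous_iff.1 hb τ ε hε
  obtain ⟨δ, hδ, hδτ, hδlt⟩ : ∃ δ > 0, δ ≤ τ ∧ δ < δ₀ :=
    ⟨min τ (δ₀ / 2), lt_min hτ.1 (by positivity), min_le_left _ _,
      (min_le_right _ _).trans_lt (by linarith)⟩
  have hσ : τ - δ ∈ Icc 0 T := ⟨by linarith, by linarith [hτ.2]⟩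
  obtain ⟨A, C, hA, hC, hAC⟩ := (hG.sourceSymbol_of_zero hh hb hH hB hσ).exists_nonneg
  have hH0 : 0 ≤ H := (abs_nonneg _).trans (hH τ ⟨hτ.1.le, hτ.2.le⟩)
  have hB0 : 0 ≤ B := (abs_nonneg _).trans (hB τ ⟨hτ.1.le, hτ.2.le⟩)
  refine ⟨A * Real.exp ((C + B) ^ 2 / (4 * δ)) + H * δ, fun y => ?_⟩
  set z : ℂ := y * Complex.I with hz
  have hz2 : (z ^ 2).re = -y ^ 2 := by
    rw [hz, mul_pow, Complex.I_sq, mul_neg, mul_one, ← Complex.ofReal_pow, ← Complex.ofReal_neg,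
      Complex.ofReal_re]
  have hzim : z.im = y := by simp [hz]
  have hzn : ‖z‖ = |y| := by simp [hz]
  have hby : -(b τ * y) ≤ B * |y| := by
    calc -(b τ * y) ≤ |b τ * y| := neg_le_abs _
      _ = |b τ| * |y| := abs_mul _ _
      _ ≤ _ := by gcongr; exact hB τ ⟨hτ.1.le, hτ.2.le⟩
  have hsplit := sourceSymbol_split hh hb T (τ - δ) τ z
  have hexp : ∀ x : ℝ, ‖Complex.exp ((x : ℂ) * z ^ 2)‖ = Real.exp (-x * y ^ 2) := by
    intro x
    rw [Complex.norm_exp, Complex.re_ofReal_mul, hz2]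
    ring_nf
  have heq : sourceSymbol h b T τ z = Complex.exp ((δ : ℂ) * z ^ 2) * sourceSymbol h b T (τ - δ) z -
      Complex.exp ((δ : ℂ) * z ^ 2) * sourceSymbol h b τ (τ - δ) z := by
    rw [hsplit, mul_add, ← mul_assoc, ← Complex.exp_add]
    simp
  have h1 : ‖Complex.exp ((δ : ℂ) * z ^ 2) * sourceSymbol h b T (τ - δ) z‖ * Real.exp (-(b τ * y)) ≤
      A * Real.exp ((C + B) ^ 2 / (4 * δ)) := by
    rw [norm_mul, hexp]
    calc _ ≤ Real.exp (-δ * y ^ 2) * (A * Real.exp (C * |y|)) * Real.exp (B * |y|) := by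
          gcongr
          rw [← hzn]; exact hAC z
      _ = A * Real.exp (-δ * y ^ 2 + C * |y| + B * |y|) := by
          rw [Real.exp_add, Real.exp_add]; ring
      _ ≤ _ := by
          gcongr
          -- complete the square
          rw [le_div_iff₀ (by positivity), ← sq_abs y]
          nlinarith [sq_nonneg (2 * δ * |y| - (C + B))]
  have h2 : ‖Complex.exp ((δ : ℂ) * z ^ 2) * sourceSymbol h b τ (τ - δ) z‖ * Real.exp (-(b τ * y)) ≤
      H * δ * Real.exp (ε * |y|) := by
    rw [norm_mul, hexp]
    have := norm_sourceSymbol_le (h := h) (b := b) (τ := τ - δ) (T' := τ)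
      (M := δ * y ^ 2 + b τ * y + ε * |y|) (H := H) (by linarith)
      (z := z) (fun t ht => hH t ⟨hσ.1.trans ht.1, ht.2.trans hτ.2.le⟩) (fun t ht => by
        rw [hz2, hzim]
        have hbt : |b t - b τ| ≤ ε := by
          have := hδb t (by
            rw [Real.dist_eq, abs_sub_lt_iff]
            constructor <;> linarith [ht.1, ht.2])
          exact this.le
        have : (b t - b τ) * y ≤ ε * |y| := by
          calc _ ≤ |(b t - b τ) * y| := le_abs_self _
            _ = |b t - b τ| * |y| := abs_mul _ _
            _ ≤ _ := by gcongr
        have : (t - (τ - δ)) * y ^ 2 ≤ δ * y ^ 2 := by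
          gcongr
          linarith [ht.2]
        linarith)
    calc _ ≤ Real.exp (-δ * y ^ 2) * (Real.exp (δ * y ^ 2 + b τ * y + ε * |y|) * H * (τ - (τ - δ))) *
          Real.exp (-(b τ * y)) := by gcongr
      _ = H * δ * (Real.exp (-δ * y ^ 2) * Real.exp (δ * y ^ 2 + b τ * y + ε * |y|) *
          Real.exp (-(b τ * y))) := by ring
      _ = _ := by rw [← Real.exp_add, ← Real.exp_add]; ring_nf
  calc _ ≤ (‖Complex.exp ((δ : ℂ) * z ^ 2) * sourceSymbol h b T (τ - δ) z‖ +
        ‖Complex.exp ((δ : ℂ) * z ^ 2) * sourceSymbol h b τ (τ - δ) z‖) * Real.exp (-(b τ * y)) := by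
        rw [heq]; gcongr; exact norm_sub_le _ _
    _ ≤ A * Real.exp ((C + B) ^ 2 / (4 * δ)) + H * δ * Real.exp (ε * |y|) := by
        rw [add_mul]; exact add_le_add h1 h2
    _ ≤ _ := by
        have : 1 ≤ Real.exp (ε * |y|) := Real.one_le_exp (by positivity)
        rw [add_mul]
        exact add_le_add (le_mul_of_one_le_right (by positivity) this) le_rfl

/-- The symbol of a final time segment, recentred at the position of the source, is bounded on the
real axis and of type zero along the imaginary axis. So it is constant, by Phragmén–Lindelöf and
Liouville, and the constant is zero because the symbol decays on the real axis. -/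
lemma sourceSymbol_eq_zero (hh : Continuous h) (hb : Continuous b)
    (hG : IsExpType (sourceSymbol h b T 0)) {τ : ℝ} (hτ : τ ∈ Ioo 0 T) (z : ℂ) :
    sourceSymbol h b T τ z = 0 := by
  obtain ⟨H, hH⟩ := isCompact_Icc.exists_bound_of_continuousOn (s := Icc 0 T) hh.continuousOn
  obtain ⟨B, hB⟩ := isCompact_Icc.exists_bound_of_continuousOn (s := Icc 0 T) hb.continuousOn
  simp only [Real.norm_eq_abs] at hH hB
  have hτT := hτ.2.le
  have hτI : τ ∈ Icc 0 T := ⟨hτ.1.le, hτT⟩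
  have hH0 : 0 ≤ H := (abs_nonneg _).trans (hH τ hτI)
  have hB0 : 0 ≤ B := (abs_nonneg _).trans (hB τ hτI)
  obtain ⟨A, C, hA, hC, hAC⟩ := (hG.sourceSymbol_of_zero hh hb hH hB hτI).exists_nonneg
  -- the recentred symbol, with the real and imaginary axes exchanged
  set f : ℂ → ℂ := fun w => sourceSymbol h b T τ (w * Complex.I) * Complex.exp (-(b τ : ℂ) * w)
    with hf
  have hfdiff : Differentiable ℂ f := by
    have := differentiable_sourceSymbol hh hb hτT
    fun_prop
  have hfn : ∀ w, ‖f w‖ = ‖sourceSymbol h b T τ (w * Complex.I)‖ * Real.exp (-(b τ * w.re)) := by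
    intro w
    rw [hf, norm_mul, Complex.norm_exp, ← Complex.ofReal_neg, Complex.re_ofReal_mul, neg_mul]
  have hfexp : IsExpType f := by
    refine ⟨A, C + B, fun w => ?_⟩
    rw [hfn, add_mul, Real.exp_add, ← mul_assoc]
    have h1 := hAC (w * Complex.I)
    rw [norm_mul, Complex.norm_I, mul_one] at h1
    refine mul_le_mul h1 (Real.exp_le_exp.2 ?_) (Real.exp_pos _).le (by positivity)
    calc -(b τ * w.re) ≤ |b τ * w.re| := neg_le_abs _
      _ = |b τ| * |w.re| := abs_mul _ _
      _ ≤ _ := mul_le_mul (hB τ hτI) (Complex.abs_re_le_norm w) (abs_nonneg _) hB0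
  have hfaxis : ∀ y : ℝ, ‖f (y * Complex.I)‖ = ‖sourceSymbol h b T τ ((-y : ℝ) : ℂ)‖ := by
    intro y
    rw [hfn, mul_assoc, Complex.I_mul_I]
    simp
  have hfim : ∀ y : ℝ, ‖f (y * Complex.I)‖ ≤ Real.exp 0 * H * (T - τ) := by
    intro y
    rw [hfaxis]
    refine norm_sourceSymbol_le hτT (fun t ht => hH t ⟨hτ.1.le.trans ht.1, ht.2⟩) fun t ht => ?_
    rw [← Complex.ofReal_pow, Complex.ofReal_re, Complex.ofReal_im]
    have := mul_nonneg (sub_nonneg.2 ht.1) (sq_nonneg (-y))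
    linarith
  have hfre : ∀ ε > 0, ∃ A, ∀ x : ℝ, ‖f x‖ ≤ A * Real.exp (ε * |x|) := by
    intro ε hε
    obtain ⟨A', hA'⟩ := norm_sourceSymbol_imag_le hh hb hH hG hB hτ hε
    exact ⟨A', fun x => by rw [hfn]; exact hA' x⟩
  have hbdd := norm_le_of_bounded_on_imaginary_axis hfdiff hfexp hfim hfre
  have hconst : ∀ w, f w = f 0 := fun w => hfdiff.apply_eq_apply_of_bounded
    ((isBounded_iff_forall_norm_le.2 ⟨_, by rintro _ ⟨w, rfl⟩; exact hbdd w⟩)) w 0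
  have hdecay : Filter.Tendsto (fun y : ℝ => sourceSymbol h b T τ (y : ℂ)) Filter.atTop (nhds 0) := by
    have h0 : (0 : ℂ) = ∫ t in τ..T, (0 : ℂ) := by simp
    rw [h0]
    refine intervalIntegral.tendsto_integral_filter_of_dominated_convergence (fun _ => H)
      (Filter.Eventually.of_forall fun y => ?_) (Filter.Eventually.of_forall fun y =>
        Filter.Eventually.of_forall fun t ht => ?_) intervalIntegrable_const
      (Filter.Eventually.of_forall fun t ht => ?_)
    · exact Continuous.aestronglyMeasurable (by fun_prop)
    · rw [uIoc_of_le hτT] at ht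
      rw [norm_mul, norm_exp_sourceSymbol, ← Complex.ofReal_pow, Complex.ofReal_re,
        Complex.ofReal_im, Complex.norm_real]
      refine (mul_le_mul (Real.exp_le_one_iff.2 ?_) (hH t ⟨hτ.1.le.trans ht.1.le, ht.2⟩)
        (abs_nonneg _) zero_le_one).trans (one_mul H).le
      have := mul_nonneg (sub_nonneg.2 ht.1.le) (sq_nonneg y)
      linarith
    · rw [uIoc_of_le hτT] at ht
      rw [tendsto_zero_iff_norm_tendsto_zero]
      have h1 : Filter.Tendsto (fun y : ℝ => Real.exp (-((t - τ) * y ^ 2)) * |h t|) Filter.atTop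
          (nhds (0 * |h t|)) := by
        refine Filter.Tendsto.mul_const _ ((Real.tendsto_exp_neg_atTop_nhds_zero).comp ?_)
        exact (Filter.tendsto_pow_atTop two_ne_zero).const_mul_atTop (sub_pos.2 ht.1)
      rw [zero_mul] at h1
      refine h1.congr fun y => ?_
      rw [norm_mul, norm_exp_sourceSymbol, ← Complex.ofReal_pow, Complex.ofReal_re,
        Complex.ofReal_im, Complex.norm_real, Real.norm_eq_abs]
      congr 2
      ring
  have hf0 : ‖f 0‖ = 0 := by
    have h1 : Filter.Tendsto (fun y : ℝ => ‖sourceSymbol h b T τ (y : ℂ)‖) Filter.atTop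
        (nhds ‖(0 : ℂ)‖) := hdecay.norm
    have h2 : (fun y : ℝ => ‖sourceSymbol h b T τ (y : ℂ)‖) = fun _ => ‖f 0‖ := by
      ext y
      have := hfaxis (-y)
      rw [neg_neg, hconst] at this
      exact this.symm
    rw [h2, norm_zero] at h1
    exact tendsto_nhds_unique tendsto_const_nhds h1
  have hfz := hconst (-z * Complex.I)
  rw [norm_eq_zero.1 hf0, hf] at hfz
  have := (mul_eq_zero.1 hfz).resolve_right (Complex.exp_ne_zero _)
  rwa [mul_assoc, Complex.I_mul_I, mul_neg_one, neg_neg] at this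

/-- A moving point source whose symbol has exponential type is zero: the symbols of the segments
`[τ, T]` vanish, and at `z = 0` they are the integrals of `h` over these segments. -/
theorem eq_zero_of_isExpType_sourceSymbol (hh : Continuous h) (hb : Continuous b) (hT : 0 < T)
    (hG : IsExpType (sourceSymbol h b T 0)) : ∀ t ∈ Icc 0 T, h t = 0 := by
  have hint : ∀ τ ∈ Ioo 0 T, ∫ t in τ..T, h t = 0 := by
    intro τ hτ
    have := sourceSymbol_eq_zero hh hb hG hτ 0
    simp only [sourceSymbol, mul_zero, ne_eq, OfNat.ofNat_ne_zero, not_false_eq_true, zero_pow,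
      zero_mul, sub_zero, Complex.exp_zero, one_mul] at this
    rw [intervalIntegral.integral_ofReal] at this
    exact_mod_cast this
  have hIoo : EqOn h (fun _ => 0) (Ioo 0 T) := by
    intro τ hτ
    have hd := intervalIntegral.integral_hasDerivAt_left (hh.intervalIntegrable τ T)
      (hh.stronglyMeasurableAtFilter _ _) hh.continuousAt
    have h0 : HasDerivAt (fun u => ∫ t in u..T, h t) 0 τ := by
      refine (hasDerivAt_const τ (0 : ℝ)).congr_of_eventuallyEq ?_
      filter_upwards [isOpen_Ioo.mem_nhds hτ] with u hu using hint u hu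
    have := hd.unique h0
    simpa using this
  intro t ht
  have := hIoo.closure hh continuous_const
  rw [closure_Ioo hT.ne] at this
  exact this ht

end PointSource

/-! ### Quotients of functions of exponential type -/

section ExpTypeQuotient

open Real in
/-- Integration over a disk in polar coordinates, in terms of circle averages. -/
lemma setIntegral_ball_eq_circleAverage {φ : ℂ → ℝ} (hφ : Continuous φ) (r : ℝ) (hr : 0 ≤ r) :
    ∫ z in Metric.ball (0 : ℂ) r, φ z = ∫ ρ in (0 : ℝ)..r, 2 * π * (ρ * circleAverage φ 0 ρ) := by
  have hsymm : ∀ p : ℝ × ℝ, Complex.polarCoord.symm p = circleMap 0 p.1 p.2 := by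
    intro p
    rw [Complex.polarCoord_symm_apply, circleMap, Complex.exp_mul_I]
    push_cast
    ring
  have havg : ∀ ρ : ℝ, 2 * π * (ρ * circleAverage φ 0 ρ) =
      ∫ θ in Ioo (-π) π, ρ * φ (circleMap 0 ρ θ) := by
    intro ρ
    rw [integral_const_mul, circleAverage_eq_integral_add (-π),
      intervalIntegral.integral_comp_add_right (f := fun θ => φ (circleMap 0 ρ θ)),
      zero_add, show 2 * π + -π = π by ring, intervalIntegral.integral_of_le (by linarith [pi_pos]),
      integral_Ioc_eq_integral_Ioo, smul_eq_mul]
    field_simp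
  rw [← integral_indicator Metric.isOpen_ball.measurableSet, ← Complex.integral_comp_polarCoord_symm,
    polarCoord_target, intervalIntegral.integral_of_le hr, integral_Ioc_eq_integral_Ioo]
  simp_rw [havg]
  have hint : IntegrableOn (fun p : ℝ × ℝ => p.1 * φ (circleMap 0 p.1 p.2))
      (Ioo 0 r ×ˢ Ioo (-π) π) (volume.prod volume) := by
    have hc : Continuous (fun p : ℝ × ℝ => p.1 * φ (circleMap 0 p.1 p.2)) := by
      unfold circleMap
      fun_prop
    exact (hc.continuousOn.integrableOn_compact (isCompact_Icc.prod isCompact_Icc)).mono_set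
      (prod_mono Ioo_subset_Icc_self Ioo_subset_Icc_self)
  rw [← setIntegral_prod _ hint]
  have hsub : Ioo 0 r ×ˢ Ioo (-π) π ⊆ Ioi (0 : ℝ) ×ˢ Ioo (-π) π :=
    prod_mono Ioo_subset_Ioi_self le_rfl
  rw [setIntegral_eq_of_subset_of_forall_sdiff_eq_zero (measurableSet_Ioi.prod measurableSet_Ioo)
    hsub, ← Measure.volume_eq_prod]
  · refine setIntegral_congr_fun (measurableSet_Ioo.prod measurableSet_Ioo) ?_
    rintro ⟨ρ, θ⟩ ⟨⟨h1, h2⟩, h3⟩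
    simp only [hsymm, smul_eq_mul]
    rw [indicator_of_mem]
    simpa [abs_of_pos h1] using h2
  · rintro ⟨ρ, θ⟩ ⟨⟨h1, h2⟩, h3⟩
    simp only [hsymm, smul_eq_mul]
    rw [indicator_of_notMem, mul_zero]
    intro h4
    simp only [mem_Ioi] at h1
    have h5 : ρ < r := by simpa [abs_of_pos h1] using h4
    exact h3 ⟨⟨h1, h5⟩, h2⟩

open Real in
/-- Subharmonicity of `log ‖f‖`, from Jensen's formula. -/
lemma log_norm_le_circleAverage_posLog {f : ℂ → ℂ} (hf : Differentiable ℂ f) {w : ℂ} (hw : f w ≠ 0)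
    {ρ : ℝ} (hρ : 0 < ρ) : log ‖f w‖ ≤ circleAverage (fun z => log⁺ ‖f z‖) w ρ := by
  have han : AnalyticOnNhd ℂ f univ := fun z _ => hf.analyticAt z
  have hanb := han.mono (subset_univ (Metric.closedBall w |ρ|))
  have hJ := hanb.circleAverage_log_norm hρ.ne' hw
  have hsum : 0 ≤ ∑ᶠ u, MeromorphicOn.divisor f (Metric.closedBall w |ρ|) u *
      log (ρ * ‖w - u‖⁻¹) := by
    refine finsum_nonneg fun u => ?_
    by_cases hu : u ∈ Metric.closedBall w |ρ|
    · refine mul_nonneg (mod_cast MeromorphicOn.AnalyticOnNhd.divisor_nonneg hanb u) ?_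
      by_cases hwu : w = u
      · simp [hwu]
      · rw [mem_closedBall_iff_norm', abs_of_pos hρ] at hu
        apply log_nonneg
        rw [← div_eq_mul_inv, one_le_div (norm_pos_iff.2 (sub_ne_zero.2 hwu))]
        exact hu
    · simp [hu]
  calc log ‖f w‖ ≤ circleAverage (fun z => log ‖f z‖) w ρ := by linarith
    _ ≤ circleAverage (fun z => log⁺ ‖f z‖) w ρ := by
      refine circleAverage_mono ?_ ?_ fun z _ => ?_
      · exact ((han.mono (subset_univ _)).meromorphicOn).circleIntegrable_log_norm
      · have := hf.continuous
        exact ContinuousOn.circleIntegrable' (Continuous.continuousOn (by fun_prop))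
      · rw [posLog_apply]; exact le_max_right _ _

lemma meromorphicOrderAt_ne_top_of_differentiable {f : ℂ → ℂ} (hf : Differentiable ℂ f) {z₀ : ℂ}
    (h₀ : f z₀ ≠ 0) (z : ℂ) : meromorphicOrderAt f z ≠ ⊤ := by
  intro h
  rw [meromorphicOrderAt_eq_top_iff] at h
  have h1 : ∀ᶠ w in nhds z, f w = 0 :=
    ((hf.analyticAt z).frequently_zero_iff_eventually_zero).1 h.frequently
  have h2 : AnalyticOnNhd ℂ f univ := fun w _ => hf.analyticAt w
  exact h₀ (h2.eqOn_zero_of_preconnected_of_eventuallyEq_zero isPreconnected_univ (mem_univ z) h1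
    (mem_univ z₀))

open ValueDistribution in
/-- An entire function has no poles to count. -/
lemma characteristic_top_eq_proximity {f : ℂ → ℂ} (hf : Differentiable ℂ f) :
    characteristic f ⊤ = proximity f ⊤ := by
  have h : AnalyticOnNhd ℂ f univ := fun w _ => hf.analyticAt w
  rw [characteristic, logCounting_top, negPart_eq_zero.2 (MeromorphicOn.AnalyticOnNhd.divisor_nonneg h)]
  simp

open Real ValueDistribution in
/-- The Nevanlinna characteristic of a function of exponential type grows at most linearly. -/
lemma IsExpType.characteristic_le {f : ℂ → ℂ} (hf : Differentiable ℂ f) (h : IsExpType f) :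
    ∃ A C : ℝ, ∀ r ≥ 0, characteristic f ⊤ r ≤ A + C * r := by
  obtain ⟨A, C, hA, hC, hAC⟩ := h.exists_nonneg
  refine ⟨log⁺ A, C, fun r hr => ?_⟩
  rw [characteristic_top_eq_proximity hf, proximity_top]
  refine circleAverage_mono_on_of_le_circle ?_ fun z hz => ?_
  · have := hf.continuous
    exact ContinuousOn.circleIntegrable' (Continuous.continuousOn (by fun_prop))
  · have hz' : ‖z‖ = r := by simpa [abs_of_nonneg hr] using hz
    calc log⁺ ‖f z‖ ≤ log⁺ (A * exp (C * r)) :=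
          posLog_le_posLog (norm_nonneg _) (by rw [← hz']; exact hAC z)
      _ ≤ log⁺ A + log⁺ (exp (C * r)) := posLog_mul
      _ = _ := by rw [posLog_apply (x := exp _), log_exp, max_eq_right (by positivity)]

open Real ValueDistribution in
/-- The averages of `log⁺ ‖Q‖` over circles about the origin grow linearly, by the first main
theorem of Nevanlinna theory. -/
lemma exists_circleAverage_posLog_quotient_le {U F Q : ℂ → ℂ} (hF : Differentiable ℂ F)
    (hQ : Differentiable ℂ Q) (hU : ∀ z, U z = F z * Q z) (hFe : IsExpType F) (hUe : IsExpType U)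
    {z₁ z₂ : ℂ} (hF0 : F z₁ ≠ 0) (hQ0 : Q z₂ ≠ 0) :
    ∃ A C : ℝ, 0 ≤ A ∧ 0 ≤ C ∧
      ∀ r ≥ 0, circleAverage (fun z => log⁺ ‖Q z‖) 0 r ≤ A + C * r := by
  have hUF : U = F * Q := funext hU
  have hUd : Differentiable ℂ U := by rw [hUF]; exact hF.mul hQ
  have hmF : Meromorphic F := fun z => (hF.analyticAt z).meromorphicAt
  have hmU : Meromorphic U := fun z => (hUd.analyticAt z).meromorphicAt
  have hoF := meromorphicOrderAt_ne_top_of_differentiable hF hF0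
  have hoQ := meromorphicOrderAt_ne_top_of_differentiable hQ hQ0
  have hoU : ∀ z, meromorphicOrderAt U z ≠ ⊤ := by
    intro z
    rw [hUF, meromorphicOrderAt_mul (hmF z) (hQ.analyticAt z).meromorphicAt]
    simp [hoF z, hoQ z]
  obtain ⟨A₁, C₁, h₁⟩ := hUe.characteristic_le hUd
  obtain ⟨A₂, C₂, h₂⟩ := hFe.characteristic_le hF
  obtain ⟨A₃, h₃⟩ : ∃ A₃, ∀ r, characteristic F⁻¹ ⊤ r ≤ characteristic F ⊤ r + A₃ :=
    ⟨_, fun r => by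
      have := neg_le_of_abs_le (characteristic_sub_characteristic_inv_le hmF (R := r))
      rw [neg_le_sub_iff_le_add] at this
      exact this⟩
  have hcod : Q =ᶠ[Filter.codiscrete ℂ] U * F⁻¹ := by
    have : AnalyticOnNhd ℂ F univ := fun w _ => hF.analyticAt w
    filter_upwards [this.preimage_zero_mem_codiscrete hF0] with z hz
    have hz' : F z ≠ 0 := by simpa using hz
    rw [Pi.mul_apply, Pi.inv_apply, hU]
    field_simp
  have hcQ : Continuous (fun z => log⁺ ‖Q z‖) := by
    have := hQ.continuous
    fun_prop
  -- the inequality for the characteristic of a product needs `1 ≤ r`; small radii are compact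
  obtain ⟨K, hK⟩ := isCompact_Icc.exists_bound_of_continuousOn (s := Icc (0 : ℝ) 1)
    (hcQ.circleAverage (c := 0)).continuousOn
  refine ⟨|K| + |A₁| + |A₂| + |A₃|, |C₁| + |C₂|, by positivity, by positivity, fun r hr => ?_⟩
  rcases le_total r 1 with hr1 | hr1
  · have := (le_abs_self _).trans ((hK r ⟨hr, hr1⟩).trans (le_abs_self K))
    have : 0 ≤ (|C₁| + |C₂|) * r := by positivity
    linarith [abs_nonneg A₁, abs_nonneg A₂, abs_nonneg A₃]
  · have e1 : circleAverage (fun z => log⁺ ‖Q z‖) 0 r = characteristic (U * F⁻¹) ⊤ r := by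
      rw [← characteristic_congr_codiscrete hcod (by positivity), characteristic_top_eq_proximity hQ,
        proximity_top]
    have e2 := characteristic_mul_top_le hr1 hmU hoU hmF.inv (fun z => by
      rw [meromorphicOrderAt_inv]; simpa using hoF z)
    rw [Pi.add_apply] at e2
    rw [e1]
    have : C₁ * r ≤ |C₁| * r := by gcongr; exact le_abs_self _
    have : C₂ * r ≤ |C₂| * r := by gcongr; exact le_abs_self _
    have e3 := e2.trans (add_le_add (h₁ r hr) ((h₃ r).trans (add_le_add_left (h₂ r hr) A₃)))
    refine e3.trans ?_
    linarith [le_abs_self A₁, le_abs_self A₂, le_abs_self A₃, abs_nonneg K]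

open Real in
/-- If a product of entire functions and one nonzero factor have exponential type, then so does the
other factor. The linear growth of the circle averages of `log⁺ ‖Q‖` passes to the averages over
disks about the origin, and those dominate `log ‖Q‖` pointwise, by subharmonicity. -/
theorem IsExpType.of_mul {U F Q : ℂ → ℂ} (hF : Differentiable ℂ F)
    (hQ : Differentiable ℂ Q) (hU : ∀ z, U z = F z * Q z) (hFe : IsExpType F) (hUe : IsExpType U)
    {z₁ : ℂ} (hF0 : F z₁ ≠ 0) : IsExpType Q := by
  by_cases hQ0 : ∃ z₂, Q z₂ ≠ 0
  swap
  · push Not at hQ0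
    exact ⟨0, 0, fun z => by simp [hQ0]⟩
  obtain ⟨z₂, hQ0⟩ := hQ0
  obtain ⟨A, C, hA, hC, hAC⟩ := exists_circleAverage_posLog_quotient_le hF hQ hU hFe hUe hF0 hQ0
  set φ : ℂ → ℝ := fun z => log⁺ ‖Q z‖ with hφ
  have hφc : Continuous φ := by
    have := hQ.continuous
    fun_prop
  have hφ0 : ∀ z, 0 ≤ φ z := fun z => posLog_nonneg
  -- The disk of radius `s = ‖w‖ + 1` about `w` lies in the disk of radius `2 s` about the origin, and
  -- the integral of `φ` over the latter is at most `2 π (2 s)² (A + 2 C s)`; division by the area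
  -- `π s²` leaves `8 (A + 2 C s)`.
  refine ⟨exp (8 * (A + 2 * C)), 16 * C, fun w => ?_⟩
  by_cases hw : Q w = 0
  · rw [hw, norm_zero]; positivity
  rw [← exp_add, ← log_le_iff_le_exp (norm_pos_iff.2 hw)]
  set s : ℝ := ‖w‖ + 1 with hs
  have hs0 : 0 < s := by positivity
  have h1 : ∫ ρ in (0 : ℝ)..s, 2 * π * (ρ * log ‖Q w‖) ≤
      ∫ ρ in (0 : ℝ)..s, 2 * π * (ρ * circleAverage (fun z => φ (z + w)) 0 ρ) := by
    refine intervalIntegral.integral_mono_on_of_le_Ioo hs0.le ?_ ?_ fun ρ hρ => ?_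
    · apply Continuous.intervalIntegrable
      fun_prop
    · apply Continuous.intervalIntegrable
      fun_prop
    · rw [circleAverage_map_add_const (f := φ)]
      have := log_norm_le_circleAverage_posLog hQ hw hρ.1
      have := hρ.1
      gcongr
  have h2 : ∫ z in Metric.ball (0 : ℂ) s, φ (z + w) = ∫ z in Metric.ball w s, φ z := by
    have := (measurePreserving_add_right volume w).setIntegral_preimage_emb
      (measurableEmbedding_addRight w) φ (Metric.ball w s)
    rw [← this]
    congr 2
    ext z
    simp [dist_eq_norm]
  have h3 : ∫ z in Metric.ball w s, φ z ≤ ∫ z in Metric.ball (0 : ℂ) (2 * s), φ z := by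
    refine setIntegral_mono_set ?_ (Filter.Eventually.of_forall hφ0) ?_
    · exact (hφc.continuousOn.integrableOn_compact (isCompact_closedBall _ _)).mono_set
        Metric.ball_subset_closedBall
    · refine (Metric.ball_subset_ball' ?_).eventuallyLE
      rw [dist_zero_right]
      linarith
  have h4 : ∫ ρ in (0 : ℝ)..(2 * s), 2 * π * (ρ * circleAverage φ 0 ρ) ≤
      ∫ ρ in (0 : ℝ)..(2 * s), 2 * π * (2 * s * (A + C * (2 * s))) := by
    refine intervalIntegral.integral_mono_on (by positivity) ?_ (by simp) fun ρ hρ => ?_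
    · apply Continuous.intervalIntegrable
      fun_prop
    · have h5 := hAC ρ hρ.1
      have h6 : A + C * ρ ≤ A + C * (2 * s) := by gcongr; exact hρ.2
      have h7 : 0 ≤ circleAverage φ 0 ρ := circleAverage_nonneg_of_nonneg fun z _ => hφ0 z
      exact mul_le_mul_of_nonneg_left (mul_le_mul hρ.2 (h5.trans h6) h7 (by positivity))
        (by positivity)
  rw [← setIntegral_ball_eq_circleAverage (by fun_prop) _ hs0.le, h2] at h1
  rw [← setIntegral_ball_eq_circleAverage hφc _ (by positivity)] at h4
  have h5 := h1.trans (h3.trans h4)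
  rw [intervalIntegral.integral_const_mul, intervalIntegral.integral_mul_const, integral_id,
    intervalIntegral.integral_const, smul_eq_mul] at h5
  have h6 : (π * s ^ 2) * log ‖Q w‖ ≤ (π * s ^ 2) * (8 * (A + C * (2 * s))) := by
    calc _ = 2 * π * ((s ^ 2 - 0 ^ 2) / 2 * log ‖Q w‖) := by ring
      _ ≤ _ := h5
      _ = _ := by ring
  have h7 := le_of_mul_le_mul_left h6 (by positivity)
  calc _ ≤ _ := h7
    _ = _ := by rw [hs]; ring

end ExpTypeQuotient

/-! ### Weak derivatives and integration by parts in time -/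

section WeakDerivative

lemma integrable_Lp_mul {v φ : R3 → ℝ} (hv : MemLp v 2) (hφ : MemLp φ 2) :
    Integrable (fun x => v x * φ x) := by
  have := MemLp.integrable_mul hv hφ
  exact this

/-- Weak derivatives may be tested against smooth functions that are square-integrable together with
the derivative in question: cut off and let the cutoff tend to one. -/
lemma HasWeakPartial.integral_mul_fderiv {i : Fin 3} {v w : L2R3} (h : HasWeakPartial i v w)
    {φ : R3 → ℝ} (hφ : ContDiff ℝ ∞ φ) (hφ2 : MemLp φ 2)
    (hdφ : MemLp (fun x => fderiv ℝ φ x (EuclideanSpace.single i (1 : ℝ))) 2) :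
    ∫ x, v x * fderiv ℝ φ x (EuclideanSpace.single i (1 : ℝ)) = - ∫ x, w x * φ x := by
  set e : R3 := EuclideanSpace.single i (1 : ℝ) with he
  let χ : ContDiffBump (0 : R3) := ⟨1, 2, one_pos, one_lt_two⟩
  have hχd : ContDiff ℝ ∞ χ := χ.contDiff
  have hχ1 : ∀ x, |χ x| ≤ 1 := fun x => abs_le.2 ⟨by linarith [χ.nonneg (x := x)], χ.le_one⟩
  obtain ⟨M, hM⟩ : ∃ M, ∀ x, ‖fderiv ℝ χ x‖ ≤ M :=
    (χ.hasCompactSupport.fderiv (𝕜 := ℝ)).exists_bound_of_continuous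
      (hχd.continuous_fderiv (by simp))
  set c : ℕ → ℝ := fun n => ((n : ℝ) + 1)⁻¹ with hc
  have hc0 : ∀ n, 0 < c n := fun n => by positivity
  have hc1 : ∀ n, c n ≤ 1 := fun n => inv_le_one_of_one_le₀ (by linarith [n.cast_nonneg (α := ℝ)])
  have hclim : Filter.Tendsto c Filter.atTop (nhds 0) := by
    simpa [hc] using tendsto_one_div_add_atTop_nhds_zero_nat (𝕜 := ℝ)
  set ψ : ℕ → R3 → ℝ := fun n x => χ (c n • x) * φ x with hψ
  have hsm : ∀ n, ContDiff ℝ ∞ (fun x : R3 => χ (c n • x)) := fun n =>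
    hχd.comp (contDiff_const_smul _)
  have hderχ : ∀ n x, fderiv ℝ (fun x : R3 => χ (c n • x)) x e = c n * fderiv ℝ χ (c n • x) e := by
    intro n x
    have h1 : HasFDerivAt (fun x : R3 => χ (c n • x))
        ((fderiv ℝ χ (c n • x)).comp (c n • ContinuousLinearMap.id ℝ R3)) x :=
      ((hχd.differentiable (by simp)) _).hasFDerivAt.comp x ((hasFDerivAt_id x).const_smul (c n))
    rw [h1.fderiv]
    simp
  have hder : ∀ n x, fderiv ℝ (ψ n) x e =
      χ (c n • x) * fderiv ℝ φ x e + φ x * (c n * fderiv ℝ χ (c n • x) e) := by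
    intro n x
    rw [hψ]
    simp only
    rw [fderiv_fun_mul ((hsm n).differentiable (by simp) x) (hφ.differentiable (by simp) x)]
    simp [hderχ]
  have hkey : ∀ n, ∫ x, v x * (χ (c n • x) * fderiv ℝ φ x e + φ x * (c n * fderiv ℝ χ (c n • x) e)) =
      - ∫ x, w x * (χ (c n • x) * φ x) := by
    intro n
    have := h (ψ n) ((hsm n).mul hφ) ?_
    · simp_rw [← he, hder] at this
      exact this
    · have : HasCompactSupport (fun x : R3 => χ (c n • x)) :=
        χ.hasCompactSupport.comp_smul (hc0 n).ne'
      exact this.mul_right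
  have hv := Lp.memLp v
  have hw := Lp.memLp w
  have hee : ∀ n x, |fderiv ℝ χ (c n • x) e| ≤ M := fun n x => by
    calc |fderiv ℝ χ (c n • x) e| ≤ ‖fderiv ℝ χ (c n • x)‖ * ‖e‖ :=
          (fderiv ℝ χ (c n • x)).le_opNorm e
      _ ≤ M := by simpa [he] using hM (c n • x)
  have hone : ∀ x : R3, Filter.Tendsto (fun n => χ (c n • x)) Filter.atTop (nhds 1) := by
    intro x
    have h1 : Filter.Tendsto (fun n => c n • x) Filter.atTop (nhds ((0 : ℝ) • x)) :=
      hclim.smul_const x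
    rw [zero_smul] at h1
    have h2 := (hχd.continuous.tendsto 0).comp h1
    rwa [χ.one_of_mem_closedBall (Metric.mem_closedBall_self zero_le_one)] at h2
  have hcont : ∀ n, Continuous (fun x : R3 => fderiv ℝ χ (c n • x) e) := fun n =>
    ((hχd.continuous_fderiv (by simp)).comp (continuous_const_smul _)).clm_apply continuous_const
  have hL : Filter.Tendsto (fun n => ∫ x, v x * (χ (c n • x) * fderiv ℝ φ x e +
      φ x * (c n * fderiv ℝ χ (c n • x) e))) Filter.atTop (nhds (∫ x, v x * fderiv ℝ φ x e)) := by
    refine tendsto_integral_of_dominated_convergence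
      (fun x => |v x * fderiv ℝ φ x e| + M * |v x * φ x|) (fun n => ?_) ?_ (fun n => ?_) ?_
    · refine hv.1.mul ((((hsm n).continuous).aestronglyMeasurable.mul hdφ.1).add
        (hφ2.1.mul (((hcont n).const_smul (c n)).aestronglyMeasurable)))
    · exact (integrable_Lp_mul hv hdφ).abs.add ((integrable_Lp_mul hv hφ2).abs.const_mul M)
    · refine Filter.Eventually.of_forall fun x => ?_
      have h1 : |c n * fderiv ℝ χ (c n • x) e| ≤ M := by
        rw [abs_mul, abs_of_pos (hc0 n)]
        calc c n * |fderiv ℝ χ (c n • x) e| ≤ 1 * M :=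
              mul_le_mul (hc1 n) (hee n x) (abs_nonneg _) zero_le_one
          _ = M := one_mul M
      rw [mul_add, ← mul_assoc, mul_comm (v x), mul_assoc, ← mul_assoc (v x)]
      calc _ ≤ |χ (c n • x)| * |v x * fderiv ℝ φ x e| +
            |v x * φ x| * |c n * fderiv ℝ χ (c n • x) e| := by
              rw [← abs_mul, ← abs_mul]; exact abs_add_le _ _
        _ ≤ 1 * |v x * fderiv ℝ φ x e| + |v x * φ x| * M := by
              gcongr
              exact hχ1 _
        _ = _ := by ring
    · refine Filter.Eventually.of_forall fun x => ?_
      have h1 : Filter.Tendsto (fun n => c n * fderiv ℝ χ (c n • x) e) Filter.atTop (nhds 0) := by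
        refine squeeze_zero_norm (a := fun n => c n * M) (fun n => ?_) (by simpa using hclim.mul_const M)
        rw [Real.norm_eq_abs, abs_mul, abs_of_pos (hc0 n)]
        exact mul_le_mul_of_nonneg_left (hee n x) (hc0 n).le
      have := (((hone x).mul_const (fderiv ℝ φ x e)).add (h1.const_mul (φ x))).const_mul (v x)
      simpa using this
  have hR : Filter.Tendsto (fun n => ∫ x, w x * (χ (c n • x) * φ x)) Filter.atTop
      (nhds (∫ x, w x * φ x)) := by
    refine tendsto_integral_of_dominated_convergence (fun x => |w x * φ x|) (fun n => ?_) ?_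
      (fun n => ?_) ?_
    · exact hw.1.mul (((hsm n).continuous).aestronglyMeasurable.mul hφ2.1)
    · exact (integrable_Lp_mul hw hφ2).abs
    · refine Filter.Eventually.of_forall fun x => ?_
      rw [← mul_assoc, mul_comm (w x), mul_assoc, Real.norm_eq_abs, abs_mul]
      exact (mul_le_mul_of_nonneg_right (hχ1 _) (abs_nonneg _)).trans (one_mul _).le
    · refine Filter.Eventually.of_forall fun x => ?_
      simpa using ((hone x).mul_const (φ x)).const_mul (w x)
  refine tendsto_nhds_unique hL ?_
  simp_rw [hkey]
  exact hR.neg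

end WeakDerivative

section ProductRule

/-- Integration by parts in time for a primitive `u` of a Bochner integrable curve `w`, paired with a
family of functionals `ℓ s` that is weakly continuously differentiable. -/
lemma apply_primitive_eq_integral {E : Type*} [NormedAddCommGroup E] [NormedSpace ℝ E]
    [CompleteSpace E] {T : ℝ} (hT : 0 ≤ T) {u w : ℝ → E} (hw : IntegrableOn w (Ioc 0 T))
    (hu : ∀ t ∈ Icc 0 T, u t = ∫ s in (0 : ℝ)..t, w s) {ℓ ℓ' : ℝ → E →L[ℝ] ℝ} {N : ℝ}
    (hN : ∀ s ∈ Icc 0 T, ‖ℓ' s‖ ≤ N)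
    (hderiv : ∀ v, ∀ s ∈ Icc 0 T, HasDerivAt (fun s => ℓ s v) (ℓ' s v) s)
    (hcont : ∀ v, ContinuousOn (fun s => ℓ' s v) (Icc 0 T))
    (hint : IntegrableOn (fun s => ℓ s (w s)) (Ioc 0 T)) :
    ℓ T (u T) = ∫ s in Ioc 0 T, (ℓ s (w s) + ℓ' s (u s)) := by
  -- the integrand of the double integral over the triangle `r ≤ s`
  set H : ℝ × ℝ → ℝ := fun p => (Iic p.2).indicator (fun _ => ℓ' p.2 (w p.1)) p.1 with hH
  have hHint : Integrable H ((volume.restrict (Ioc 0 T)).prod (volume.restrict (Ioc 0 T))) := by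
    have hmeas : AEStronglyMeasurable (fun p : ℝ × ℝ => ℓ' p.2 (w p.1))
        ((volume.restrict (Ioc 0 T)).prod (volume.restrict (Ioc 0 T))) := by
      -- composition with the projection onto `[0, T]` makes the functionals continuous everywhere
      obtain ⟨w', hw', hww'⟩ := hw.1
      have hsm := stronglyMeasurable_uncurry_of_continuous_of_stronglyMeasurable
        (u := fun (s : ℝ) (r : ℝ) => ℓ' (projIcc 0 T hT s) (w' r)) (fun r => by
          have := (hcont (w' r)).domRestrict.comp (continuous_projIcc (h := hT))
          exact this) (fun s => (ℓ' (projIcc 0 T hT s)).continuous.comp_stronglyMeasurable hw')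
      refine ⟨_, hsm.comp_measurable measurable_swap, ?_⟩
      have h1 := (Measure.quasiMeasurePreserving_fst (μ := volume.restrict (Ioc 0 T))
        (ν := volume.restrict (Ioc 0 T))).ae hww'
      have h2 := (Measure.quasiMeasurePreserving_snd (μ := volume.restrict (Ioc 0 T))
        (ν := volume.restrict (Ioc 0 T))).ae (ae_restrict_mem measurableSet_Ioc)
      filter_upwards [h1, h2] with p hp1 hp2
      simp only [Function.comp, Function.uncurry, Prod.fst_swap, Prod.snd_swap]
      rw [projIcc_of_mem hT (Ioc_subset_Icc_self hp2), hp1]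
    have hset : MeasurableSet {p : ℝ × ℝ | p.1 ≤ p.2} := measurableSet_le measurable_fst measurable_snd
    have hHeq : H = {p : ℝ × ℝ | p.1 ≤ p.2}.indicator (fun p => ℓ' p.2 (w p.1)) := by
      ext p
      simp [hH, indicator]
    have hdom : Integrable (fun p : ℝ × ℝ => ℓ' p.2 (w p.1))
        ((volume.restrict (Ioc 0 T)).prod (volume.restrict (Ioc 0 T))) := by
      have hb : Integrable (fun p : ℝ × ℝ => N * ‖w p.1‖)
          ((volume.restrict (Ioc 0 T)).prod (volume.restrict (Ioc 0 T))) :=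
        (hw.norm.comp_fst _).const_mul N
      refine hb.mono' hmeas ?_
      have h2 := (Measure.quasiMeasurePreserving_snd (μ := volume.restrict (Ioc 0 T))
        (ν := volume.restrict (Ioc 0 T))).ae (ae_restrict_mem measurableSet_Ioc)
      filter_upwards [h2] with p hp2
      exact (ℓ' p.2).le_of_opNorm_le (hN _ (Ioc_subset_Icc_self hp2)) _
    rw [hHeq]
    exact hdom.indicator hset
  have hswap := integral_integral_swap (f := fun r s => H (r, s)) hHint
  have hleft : ∀ r ∈ Ioc 0 T, ∫ s in Ioc 0 T, H (r, s) = ℓ T (w r) - ℓ r (w r) := by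
    intro r hr
    have hsub : Icc r T ⊆ Icc 0 T := Icc_subset_Icc_left hr.1.le
    have h1 : ∫ s in Ioc 0 T, H (r, s) = ∫ s in Icc r T, ℓ' s (w r) := by
      have : (fun s => H (r, s)) = (Ici r).indicator (fun s => ℓ' s (w r)) := by
        ext s
        simp [hH, indicator]
      rw [this, setIntegral_indicator measurableSet_Ici]
      congr 2
      ext s
      simp only [mem_inter_iff, mem_Ioc, mem_Ici, mem_Icc]
      constructor
      · rintro ⟨h1, h2⟩; exact ⟨h2, h1.2⟩
      · rintro ⟨h1, h2⟩; exact ⟨⟨hr.1.trans_le h1, h2⟩, h1⟩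
    rw [h1, integral_Icc_eq_integral_Ioc, ← intervalIntegral.integral_of_le hr.2]
    refine intervalIntegral.integral_eq_sub_of_hasDerivAt (f := fun s => ℓ s (w r))
      (f' := fun s => ℓ' s (w r)) (fun s hs => ?_) ?_
    · rw [uIcc_of_le hr.2] at hs
      exact hderiv _ s (hsub hs)
    · apply ContinuousOn.intervalIntegrable
      rw [uIcc_of_le hr.2]
      exact (hcont _).mono hsub
  have hright : ∀ s ∈ Ioc 0 T, ∫ r in Ioc 0 T, H (r, s) = ℓ' s (u s) := by
    intro s hs
    have hcomm := (ℓ' s).integral_comp_comm (φ := w) (μ := volume.restrict (Ioc 0 s))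
      (hw.mono_set (Ioc_subset_Ioc_right hs.2))
    rw [hu s (Ioc_subset_Icc_self hs), intervalIntegral.integral_of_le hs.1.le, ← hcomm]
    have : (fun r => H (r, s)) = (Iic s).indicator (fun r => ℓ' s (w r)) := rfl
    rw [this, setIntegral_indicator measurableSet_Iic]
    congr 2
    ext r
    simp only [mem_inter_iff, mem_Ioc, mem_Iic]
    constructor
    · rintro ⟨h1, h2⟩; exact ⟨h1.1, h2⟩
    · rintro ⟨h1, h2⟩; exact ⟨⟨h1, h2.trans hs.2⟩, h2⟩
  have hint' : IntegrableOn (fun s => ℓ' s (u s)) (Ioc 0 T) := by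
    refine (hHint.integral_prod_right).congr ?_
    filter_upwards [ae_restrict_mem measurableSet_Ioc] with s hs using hright s hs
  rw [setIntegral_congr_fun measurableSet_Ioc hleft, setIntegral_congr_fun measurableSet_Ioc hright,
    integral_sub ((ℓ T).integrable_comp hw) hint, (ℓ T).integral_comp_comm hw,
    ← intervalIntegral.integral_of_le hT, ← hu T (right_mem_Icc.2 hT)] at hswap
  rw [integral_add hint hint', ← hswap]
  ring

end ProductRule

/-! ### The heat kernel -/

section HeatKernel

/-- The heat kernel of `ℝ³` at time `τ > 0`; the values for `τ ≤ 0` carry no meaning. -/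
noncomputable def heatKernel (τ : ℝ) (x : R3) : ℝ :=
  (4 * Real.pi * τ) ^ (-(3 / 2) : ℝ) * Real.exp (-‖x‖ ^ 2 / (4 * τ))

/-- The time derivative of the heat kernel of `ℝ³`; it is also its Laplacian. -/
noncomputable def heatKernelDt (τ : ℝ) (x : R3) : ℝ :=
  (‖x‖ ^ 2 / (4 * τ ^ 2) - 3 / (2 * τ)) * heatKernel τ x

lemma heatKernel_nonneg {τ : ℝ} (hτ : 0 < τ) (x : R3) : 0 ≤ heatKernel τ x := by
  unfold heatKernel
  positivity

lemma hasDerivAt_heatKernel {τ : ℝ} (hτ : 0 < τ) (x : R3) :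
    HasDerivAt (fun τ => heatKernel τ x) (heatKernelDt τ x) τ := by
  have hpos : (0 : ℝ) < 4 * Real.pi * τ := by positivity
  have h1 : HasDerivAt (fun τ : ℝ => (4 * Real.pi * τ) ^ (-(3 / 2) : ℝ))
      (4 * Real.pi * 1 * (-(3 / 2)) * (4 * Real.pi * τ) ^ ((-(3 / 2) : ℝ) - 1)) τ :=
    ((hasDerivAt_id τ).const_mul (4 * Real.pi)).rpow_const (Or.inl hpos.ne')
  have h2 : HasDerivAt (fun τ : ℝ => -‖x‖ ^ 2 / (4 * τ)) (‖x‖ ^ 2 / (4 * τ ^ 2)) τ := by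
    have := (hasDerivAt_const τ (-‖x‖ ^ 2)).div ((hasDerivAt_id τ).const_mul 4) (by simp; positivity)
    refine this.congr_deriv ?_
    simp only [id]
    field_simp
    ring
  refine (h1.mul h2.exp).congr_deriv ?_
  rw [Real.rpow_sub_one hpos.ne', heatKernelDt, heatKernel]
  field_simp
  ring

lemma continuousOn_heatKernel : ContinuousOn (fun p : ℝ × R3 => heatKernel p.1 p.2) (Ioi 0 ×ˢ univ) := by
  unfold heatKernel
  refine ContinuousOn.mul ?_ ?_
  · refine ContinuousOn.rpow_const (by fun_prop) fun p hp => Or.inl ?_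
    have : 0 < p.1 := hp.1
    positivity
  · refine Real.continuous_exp.comp_continuousOn (ContinuousOn.div (by fun_prop) (by fun_prop) ?_)
    intro p hp
    have : 0 < p.1 := hp.1
    positivity

lemma continuousOn_heatKernelDt :
    ContinuousOn (fun p : ℝ × R3 => heatKernelDt p.1 p.2) (Ioi 0 ×ˢ univ) := by
  unfold heatKernelDt
  refine ContinuousOn.mul (ContinuousOn.sub ?_ ?_) continuousOn_heatKernel
  · refine ContinuousOn.div (by fun_prop) (by fun_prop) fun p hp => ?_
    have : 0 < p.1 := hp.1
    positivity
  · refine ContinuousOn.div (by fun_prop) (by fun_prop) fun p hp => ?_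
    have : 0 < p.1 := hp.1
    positivity

lemma continuous_heatKernel (τ : ℝ) : Continuous (heatKernel τ) := by
  unfold heatKernel
  fun_prop

lemma continuous_heatKernelDt (τ : ℝ) : Continuous (heatKernelDt τ) := by
  unfold heatKernelDt heatKernel
  fun_prop

lemma contDiff_heatKernel (τ : ℝ) (c : R3) : ContDiff ℝ ∞ (fun x => heatKernel τ (x - c)) := by
  unfold heatKernel
  have : ContDiff ℝ ∞ (fun x : R3 => ‖x - c‖ ^ 2) := (contDiff_id.sub contDiff_const).norm_sq ℝ
  fun_prop

lemma hasFDerivAt_heatKernel (τ : ℝ) (c x : R3) : HasFDerivAt (fun x => heatKernel τ (x - c))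
    ((-(heatKernel τ (x - c) / (2 * τ))) • innerSL ℝ (x - c)) x := by
  have h1 : HasFDerivAt (fun x : R3 => ‖x - c‖ ^ 2) ((2 : ℝ) • innerSL ℝ (x - c)) x := by
    refine ((hasFDerivAt_id (𝕜 := ℝ) x).sub_const c).norm_sq.congr_fderiv ?_
    rw [two_smul, two_smul]
    rfl
  have h2 : HasFDerivAt (fun x : R3 => -‖x - c‖ ^ 2 / (4 * τ))
      ((-(1 / (2 * τ))) • innerSL ℝ (x - c)) x := by
    have e : (fun x : R3 => -‖x - c‖ ^ 2 / (4 * τ)) = fun x => -(1 / (4 * τ)) * ‖x - c‖ ^ 2 := by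
      ext y; ring
    rw [e]
    refine (h1.const_mul (-(1 / (4 * τ)))).congr_fderiv ?_
    rw [smul_smul]; congr 1; ring
  refine (h2.exp.const_mul ((4 * Real.pi * τ) ^ (-(3 / 2) : ℝ))).congr_fderiv ?_
  rw [smul_smul, smul_smul, heatKernel]
  congr 1
  ring

lemma fderiv_heatKernel (τ : ℝ) (c x : R3) (i : Fin 3) :
    fderiv ℝ (fun x => heatKernel τ (x - c)) x (EuclideanSpace.single i (1 : ℝ)) =
      -((x - c) i / (2 * τ)) * heatKernel τ (x - c) := by
  rw [(hasFDerivAt_heatKernel τ c x).fderiv, smul_apply, innerSL_apply_apply,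
    EuclideanSpace.inner_single_right]
  simp
  ring

lemma fderiv_fderiv_heatKernel (τ : ℝ) (c x : R3) (i : Fin 3) :
    fderiv ℝ (fun x => -((x - c) i / (2 * τ)) * heatKernel τ (x - c)) x
        (EuclideanSpace.single i (1 : ℝ)) =
      ((x - c) i ^ 2 / (4 * τ ^ 2) - 1 / (2 * τ)) * heatKernel τ (x - c) := by
  have h1 : HasFDerivAt (fun x : R3 => -((x - c) i / (2 * τ)))
      ((-(1 / (2 * τ))) • (EuclideanSpace.proj i : R3 →L[ℝ] ℝ)) x := by
    have := ((EuclideanSpace.proj i : R3 →L[ℝ] ℝ).hasFDerivAt (x := x)).sub_const (c i)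
    have e : (fun x : R3 => -((x - c) i / (2 * τ))) = fun x => -(1 / (2 * τ)) *
        ((EuclideanSpace.proj i : R3 →L[ℝ] ℝ) x - c i) := by
      ext y
      simp
      ring
    rw [e]
    exact this.const_mul (-(1 / (2 * τ)))
  rw [(h1.fun_mul (hasFDerivAt_heatKernel τ c x)).fderiv]
  simp only [add_apply, smul_apply, innerSL_apply_apply,
    EuclideanSpace.inner_single_right]
  simp
  ring

/-- Gaussian domination of the heat kernel and its derivatives, uniform for times in `[δ, S]`. -/
lemma heatKernel_mul_le {δ S : ℝ} (hδ : 0 < δ) {τ : ℝ} (hτ : τ ∈ Icc δ S) (x : R3) :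
    (1 + ‖x‖ ^ 2) * heatKernel τ x ≤
      (4 * Real.pi * δ) ^ (-(3 / 2) : ℝ) * (1 + 8 * S) * Real.exp (-‖x‖ ^ 2 / (8 * S)) := by
  have hτ0 : 0 < τ := hδ.trans_le hτ.1
  have hS : 0 < S := hτ0.trans_le hτ.2
  have h1 : (4 * Real.pi * τ) ^ (-(3 / 2) : ℝ) ≤ (4 * Real.pi * δ) ^ (-(3 / 2) : ℝ) := by
    apply Real.rpow_le_rpow_of_nonpos (by positivity) _ (by norm_num)
    have := hτ.1
    gcongr
  have h2 : Real.exp (-‖x‖ ^ 2 / (4 * τ)) ≤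
      Real.exp (-‖x‖ ^ 2 / (8 * S)) * Real.exp (-‖x‖ ^ 2 / (8 * S)) := by
    rw [← Real.exp_add, Real.exp_le_exp]
    have : ‖x‖ ^ 2 / (4 * S) ≤ ‖x‖ ^ 2 / (4 * τ) := by
      have := hτ.2
      gcongr
    have e : -‖x‖ ^ 2 / (8 * S) + -‖x‖ ^ 2 / (8 * S) = -(‖x‖ ^ 2 / (4 * S)) := by
      field_simp; ring
    rw [e, neg_div]
    linarith
  have h3 : (1 + ‖x‖ ^ 2) * Real.exp (-‖x‖ ^ 2 / (8 * S)) ≤ 1 + 8 * S := by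
    rw [neg_div, Real.exp_neg, ← div_eq_mul_inv, div_le_iff₀ (Real.exp_pos _)]
    calc 1 + ‖x‖ ^ 2 ≤ (1 + 8 * S) * (‖x‖ ^ 2 / (8 * S) + 1) := by
          have h : ‖x‖ ^ 2 = 8 * S * (‖x‖ ^ 2 / (8 * S)) := by field_simp
          have : 0 ≤ ‖x‖ ^ 2 / (8 * S) := by positivity
          nlinarith
      _ ≤ _ := by gcongr; exact Real.add_one_le_exp _
  unfold heatKernel
  calc _ ≤ (1 + ‖x‖ ^ 2) * ((4 * Real.pi * δ) ^ (-(3 / 2) : ℝ) *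
        (Real.exp (-‖x‖ ^ 2 / (8 * S)) * Real.exp (-‖x‖ ^ 2 / (8 * S)))) := by gcongr
    _ = (4 * Real.pi * δ) ^ (-(3 / 2) : ℝ) * ((1 + ‖x‖ ^ 2) * Real.exp (-‖x‖ ^ 2 / (8 * S))) *
        Real.exp (-‖x‖ ^ 2 / (8 * S)) := by ring
    _ ≤ _ := by gcongr

lemma integrable_exp_neg_norm_sq {b : ℝ} (hb : 0 < b) (c : R3) :
    Integrable (fun x : R3 => Real.exp (-b * ‖x - c‖ ^ 2)) := by
  have h := GaussianFourier.integrable_cexp_neg_mul_sq_norm_add (b := (b : ℂ)) (by simpa) 0 (0 : R3)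
  have h2 := h.norm.comp_sub_right c
  refine h2.congr (Filter.Eventually.of_forall fun x => ?_)
  simp only [Complex.norm_exp]
  norm_cast
  simp

/-- The dominating Gaussian centred at `c`. -/
lemma memLp_gaussian {S : ℝ} (hS : 0 < S) (c : R3) :
    MemLp (fun x : R3 => Real.exp (-‖x - c‖ ^ 2 / (8 * S))) 2 := by
  rw [memLp_two_iff_integrable_sq (by
    apply Continuous.aestronglyMeasurable
    fun_prop)]
  refine (integrable_exp_neg_norm_sq (b := 1 / (4 * S)) (by positivity) c).congr
    (Filter.Eventually.of_forall fun x => ?_)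
  simp only
  rw [← Real.exp_nat_mul]
  congr 1
  push_cast
  field_simp
  ring

/-- A quantity dominated by a multiple of `(1 + |x|²) k(τ, x)` has a Gaussian bound that is uniform for
`τ ∈ [δ, S]`. -/
lemma norm_le_gaussian_of_le_heatKernel {δ S τ C : ℝ} (hδ : 0 < δ) (hτ : τ ∈ Icc δ S) (hC : 0 ≤ C)
    {x : R3} {a : ℝ} (h : |a| ≤ C * ((1 + ‖x‖ ^ 2) * heatKernel τ x)) :
    |a| ≤ C * ((4 * Real.pi * δ) ^ (-(3 / 2) : ℝ) * (1 + 8 * S)) * Real.exp (-‖x‖ ^ 2 / (8 * S)) := by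
  refine h.trans ?_
  rw [mul_assoc]
  exact mul_le_mul_of_nonneg_left (heatKernel_mul_le hδ hτ x) hC

lemma abs_heatKernel_le {τ : ℝ} (hτ : 0 < τ) (x : R3) :
    |heatKernel τ x| ≤ 1 * ((1 + ‖x‖ ^ 2) * heatKernel τ x) := by
  have := heatKernel_nonneg hτ x
  rw [abs_of_nonneg this, one_mul]
  exact le_mul_of_one_le_left this (by linarith [sq_nonneg ‖x‖])

lemma abs_heatKernelDt_le {δ τ : ℝ} (hδ : 0 < δ) (hτ : δ ≤ τ) (x : R3) :
    |heatKernelDt τ x| ≤ (1 / (4 * δ ^ 2) + 3 / (2 * δ)) * ((1 + ‖x‖ ^ 2) * heatKernel τ x) := by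
  have hτ0 : 0 < τ := hδ.trans_le hτ
  rw [heatKernelDt, abs_mul, abs_of_nonneg (heatKernel_nonneg hτ0 x), ← mul_assoc]
  refine mul_le_mul_of_nonneg_right ?_ (heatKernel_nonneg hτ0 x)
  have h1 : ‖x‖ ^ 2 / (4 * τ ^ 2) ≤ ‖x‖ ^ 2 / (4 * δ ^ 2) := by gcongr
  have h2 : 3 / (2 * τ) ≤ 3 / (2 * δ) := by gcongr
  have h3 : 0 ≤ ‖x‖ ^ 2 / (4 * τ ^ 2) := by positivity
  have h4 : 0 ≤ 3 / (2 * τ) := by positivity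
  have h5 : (1 / (4 * δ ^ 2) + 3 / (2 * δ)) * (1 + ‖x‖ ^ 2) = ‖x‖ ^ 2 / (4 * δ ^ 2) + 3 / (2 * δ) +
      (1 / (4 * δ ^ 2) + 3 / (2 * δ) * ‖x‖ ^ 2) := by ring
  have h6 : 0 ≤ 1 / (4 * δ ^ 2) + 3 / (2 * δ) * ‖x‖ ^ 2 := by positivity
  rw [h5, abs_le]
  constructor <;> linarith

lemma abs_coord_le (x : R3) (i : Fin 3) : |x i| ≤ 1 + ‖x‖ ^ 2 := by
  have h1 : |x i| ≤ ‖x‖ := PiLp.norm_apply_le x i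
  nlinarith [sq_nonneg (‖x‖ - 1)]

lemma coord_sq_le (x : R3) (i : Fin 3) : x i ^ 2 ≤ 1 + ‖x‖ ^ 2 := by
  have h1 : |x i| ≤ ‖x‖ := PiLp.norm_apply_le x i
  have h2 : x i ^ 2 ≤ ‖x‖ ^ 2 := sq_le_sq' (by linarith [neg_abs_le (x i)]) ((le_abs_self _).trans h1)
  linarith

lemma memLp_of_le_heatKernel {τ C : ℝ} (hτ : 0 < τ) (hC : 0 ≤ C) {c : R3} {φ : R3 → ℝ}
    (hφ : Continuous φ) (h : ∀ x, |φ x| ≤ C * ((1 + ‖x - c‖ ^ 2) * heatKernel τ (x - c))) :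
    MemLp φ 2 := by
  refine (memLp_gaussian hτ c).of_le_mul (c := C * ((4 * Real.pi * τ) ^ (-(3 / 2) : ℝ) * (1 + 8 * τ)))
    hφ.aestronglyMeasurable (Filter.Eventually.of_forall fun x => ?_)
  rw [Real.norm_eq_abs, Real.norm_eq_abs, Real.abs_exp]
  exact norm_le_gaussian_of_le_heatKernel hτ (right_mem_Icc.2 le_rfl) hC (h x)

lemma memLp_heatKernel {τ : ℝ} (hτ : 0 < τ) (c : R3) : MemLp (fun x => heatKernel τ (x - c)) 2 :=
  memLp_of_le_heatKernel hτ zero_le_one ((continuous_heatKernel τ).comp (continuous_sub_right c))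
    fun x => abs_heatKernel_le hτ (x - c)

lemma memLp_heatKernelDt {τ : ℝ} (hτ : 0 < τ) (c : R3) : MemLp (fun x => heatKernelDt τ (x - c)) 2 :=
  memLp_of_le_heatKernel hτ (by positivity) ((continuous_heatKernelDt τ).comp (continuous_sub_right c))
    fun x => abs_heatKernelDt_le hτ le_rfl (x - c)

/-- The weak Laplacian may be moved onto the heat kernel. -/
lemma integral_laplacian_mul_heatKernel {v : L2R3} {Dv : Fin 3 → L2R3} {D2v : Fin 3 → L2R3}
    (h1 : ∀ i, HasWeakPartial i v (Dv i)) (h2 : ∀ i, HasWeakPartial i (Dv i) (D2v i)) {τ : ℝ}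
    (hτ : 0 < τ) (c : R3) :
    ∑ i, ∫ x, D2v i x * heatKernel τ (x - c) = ∫ x, v x * heatKernelDt τ (x - c) := by
  have hK := memLp_heatKernel hτ c
  have hcoord : ∀ i : Fin 3, Continuous (fun x : R3 => (x - c) i) := fun i => by fun_prop
  have hKc : Continuous (fun x : R3 => heatKernel τ (x - c)) :=
    (continuous_heatKernel τ).comp (continuous_sub_right c)
  have hK1 : ∀ i : Fin 3, MemLp (fun x : R3 => -((x - c) i / (2 * τ)) * heatKernel τ (x - c)) 2 := by
    intro i
    refine memLp_of_le_heatKernel hτ (C := 1 / (2 * τ)) (c := c) (by positivity)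
      ((((hcoord i).div_const _).neg).mul hKc) fun x => ?_
    rw [abs_mul, abs_neg, abs_div, abs_of_nonneg (heatKernel_nonneg hτ _),
      abs_of_pos (show 0 < 2 * τ by positivity), ← mul_assoc]
    refine mul_le_mul_of_nonneg_right ?_ (heatKernel_nonneg hτ _)
    rw [div_mul_eq_mul_div, one_mul]
    gcongr
    exact abs_coord_le _ _
  have hK2 : ∀ i : Fin 3, MemLp (fun x : R3 =>
      ((x - c) i ^ 2 / (4 * τ ^ 2) - 1 / (2 * τ)) * heatKernel τ (x - c)) 2 := by
    intro i
    refine memLp_of_le_heatKernel hτ (C := 1 / (4 * τ ^ 2) + 1 / (2 * τ)) (c := c) (by positivity)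
      (((((hcoord i).pow 2).div_const _).sub continuous_const).mul hKc) fun x => ?_
    rw [abs_mul, abs_of_nonneg (heatKernel_nonneg hτ _), ← mul_assoc]
    refine mul_le_mul_of_nonneg_right ?_ (heatKernel_nonneg hτ _)
    have e1 := coord_sq_le (x - c) i
    have e2 : (x - c) i ^ 2 / (4 * τ ^ 2) ≤ (1 + ‖x - c‖ ^ 2) / (4 * τ ^ 2) := by gcongr
    have e3 : 0 ≤ (x - c) i ^ 2 / (4 * τ ^ 2) := by positivity
    have e4 : 0 ≤ 1 / (2 * τ) := by positivity
    have e5 : 0 ≤ 1 / (2 * τ) * ‖x - c‖ ^ 2 := by positivity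
    have e6 : (1 / (4 * τ ^ 2) + 1 / (2 * τ)) * (1 + ‖x - c‖ ^ 2) = (1 + ‖x - c‖ ^ 2) / (4 * τ ^ 2) +
      (1 / (2 * τ) + 1 / (2 * τ) * ‖x - c‖ ^ 2) := by ring
    rw [e6, abs_le]
    constructor <;> linarith
  have hK1d : ∀ i : Fin 3, ContDiff ℝ ∞
      (fun x : R3 => -((x - c) i / (2 * τ)) * heatKernel τ (x - c)) := fun i => by
    have : ContDiff ℝ ∞ (fun x : R3 => (x - c) i) :=
      (EuclideanSpace.proj i : R3 →L[ℝ] ℝ).contDiff.comp (contDiff_id.sub contDiff_const)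
    exact ((this.div_const _).neg).mul (contDiff_heatKernel τ c)
  have step : ∀ i, ∫ x, D2v i x * heatKernel τ (x - c) =
      ∫ x, v x * (((x - c) i ^ 2 / (4 * τ ^ 2) - 1 / (2 * τ)) * heatKernel τ (x - c)) := by
    intro i
    have s1 := (h2 i).integral_mul_fderiv (contDiff_heatKernel τ c) hK (by
      simp_rw [fderiv_heatKernel]; exact hK1 i)
    have s2 := (h1 i).integral_mul_fderiv (hK1d i) (hK1 i) (by
      simp_rw [fderiv_fderiv_heatKernel]; exact hK2 i)
    simp_rw [fderiv_heatKernel] at s1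
    simp_rw [fderiv_fderiv_heatKernel] at s2
    linarith
  -- the three factors `xᵢ² / (4 τ²) - 1 / (2 τ)` add up to the factor in `heatKernelDt`
  simp_rw [step]
  rw [← integral_finsetSum _ fun i _ => integrable_Lp_mul (Lp.memLp v) (hK2 i)]
  refine integral_congr_ae (Filter.Eventually.of_forall fun x => ?_)
  simp only
  rw [← Finset.mul_sum, ← Finset.sum_mul, heatKernelDt, EuclideanSpace.real_norm_sq_eq,
    Finset.sum_sub_distrib, ← Finset.sum_div]
  simp
  ring_nf
  tauto

end HeatKernel

/-! ### Duality with the backward heat kernel -/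

section Duality

open Classical in
/-- Integration against a square-integrable function, as a functional on `L²(ℝ³)` (and zero for
functions that are not square-integrable). -/
noncomputable def pairL2 (φ : R3 → ℝ) : L2R3 →L[ℝ] ℝ :=
  if h : MemLp φ 2 then innerSL ℝ h.toLp else 0

lemma pairL2_apply {φ : R3 → ℝ} (h : MemLp φ 2) (v : L2R3) : pairL2 φ v = ∫ x, v x * φ x := by
  rw [pairL2, dif_pos h, innerSL_apply_apply, L2.inner_def]
  refine integral_congr_ae ?_
  filter_upwards [h.coeFn_toLp] with x hx
  rw [hx]
  simp

lemma norm_pairL2_le {φ E : R3 → ℝ} (h : MemLp φ 2) (hE : MemLp E 2) (hle : ∀ x, |φ x| ≤ E x) :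
    ‖pairL2 φ‖ ≤ (eLpNorm E 2 volume).toReal := by
  rw [pairL2, dif_pos h, innerSL_apply_norm, Lp.norm_toLp]
  refine ENNReal.toReal_mono hE.eLpNorm_ne_top (eLpNorm_mono fun x => ?_)
  exact (hle x).trans (le_abs_self _)

variable {T δ : ℝ}

/-- The backward kernels `k(T + δ - s, x - c)` with `s` in a neighbourhood of `[0, T]`, and their time
derivatives, have a common square-integrable bound. -/
lemma exists_gaussian_bound (hT : 0 ≤ T) (hδ : 0 < δ) (c : R3) : ∃ E : R3 → ℝ, MemLp E 2 ∧
    ∀ τ ∈ Icc (δ / 2) (T + 2 * δ), ∀ x, |heatKernel τ (x - c)| ≤ E x ∧ |heatKernelDt τ (x - c)| ≤ E x := by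
  have hδ2 : 0 < δ / 2 := by positivity
  set C : ℝ := 1 + (1 / (4 * (δ / 2) ^ 2) + 3 / (2 * (δ / 2))) with hC
  refine ⟨fun x => C * ((4 * Real.pi * (δ / 2)) ^ (-(3 / 2) : ℝ) * (1 + 8 * (T + 2 * δ))) *
    Real.exp (-‖x - c‖ ^ 2 / (8 * (T + 2 * δ))), (memLp_gaussian (by positivity) c).const_mul _,
    fun τ hτ x => ?_⟩
  have hτ0 : 0 < τ := hδ2.trans_le hτ.1
  have hpos : 0 ≤ (1 + ‖x - c‖ ^ 2) * heatKernel τ (x - c) :=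
    mul_nonneg (by positivity) (heatKernel_nonneg hτ0 _)
  have hpos2 : 0 ≤ 1 / (4 * (δ / 2) ^ 2) + 3 / (2 * (δ / 2)) := by positivity
  constructor
  · refine norm_le_gaussian_of_le_heatKernel hδ2 hτ (by positivity)
      ((abs_heatKernel_le hτ0 _).trans ?_)
    exact mul_le_mul_of_nonneg_right (by linarith) hpos
  · refine norm_le_gaussian_of_le_heatKernel hδ2 hτ (by positivity)
      ((abs_heatKernelDt_le hδ2 hτ.1 _).trans ?_)
    exact mul_le_mul_of_nonneg_right (by linarith) hpos

lemma hasDerivAt_pairL2_heatKernel (hT : 0 ≤ T) (hδ : 0 < δ) (c : R3) (v : L2R3) {s : ℝ}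
    (hs : s ∈ Icc 0 T) :
    HasDerivAt (fun s => pairL2 (fun x => heatKernel (T + δ - s) (x - c)) v)
      (-pairL2 (fun x => heatKernelDt (T + δ - s) (x - c)) v) s := by
  obtain ⟨E, hE, hEb⟩ := exists_gaussian_bound hT hδ c
  have hU : Ioo (-δ) (T + δ / 2) ∈ nhds s :=
    isOpen_Ioo.mem_nhds ⟨by linarith [hs.1], by linarith [hs.2]⟩
  have hτ : ∀ s ∈ Ioo (-δ) (T + δ / 2), T + δ - s ∈ Icc (δ / 2) (T + 2 * δ) := fun s hs =>
    ⟨by linarith [hs.2], by linarith [hs.1]⟩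
  have hτ0 : ∀ s ∈ Ioo (-δ) (T + δ / 2), 0 < T + δ - s := fun s hs => by linarith [hs.2]
  have hs' : s ∈ Ioo (-δ) (T + δ / 2) := mem_of_mem_nhds hU
  have hmain := (hasDerivAt_integral_of_dominated_loc_of_deriv_le (μ := (volume : Measure R3))
    (F := fun s x => v x * heatKernel (T + δ - s) (x - c))
    (F' := fun s x => v x * -heatKernelDt (T + δ - s) (x - c))
    (bound := fun x => |v x| * E x) (x₀ := s) hU ?_ ?_ ?_ ?_ ?_ ?_).2
  · rw [pairL2_apply (memLp_heatKernelDt (hτ0 s hs') c), ← integral_neg]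
    simp only [mul_neg] at hmain
    refine hmain.congr_of_eventuallyEq ?_
    filter_upwards [hU] with s hs
    exact pairL2_apply (memLp_heatKernel (hτ0 s hs) c) v
  · filter_upwards [hU] with s hs
    exact (integrable_Lp_mul (Lp.memLp v) (memLp_heatKernel (hτ0 s hs) c)).1
  · exact integrable_Lp_mul (Lp.memLp v) (memLp_heatKernel (hτ0 s hs') c)
  · exact (integrable_Lp_mul (Lp.memLp v) (memLp_heatKernelDt (hτ0 s hs') c).neg).1
  · refine Filter.Eventually.of_forall fun x s hs => ?_
    rw [norm_mul, norm_neg]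
    exact mul_le_mul_of_nonneg_left (hEb _ (hτ s hs) x).2 (norm_nonneg _)
  · exact integrable_Lp_mul (Lp.memLp v).abs hE
  · refine Filter.Eventually.of_forall fun x s hs => ?_
    have h1 := (hasDerivAt_heatKernel (hτ0 s hs) (x - c)).comp s ((hasDerivAt_id s).const_sub (T + δ))
    have h2 := h1.const_mul (v x)
    refine h2.congr_deriv ?_
    ring

lemma continuousOn_pairL2_heatKernelDt (hT : 0 ≤ T) (hδ : 0 < δ) (c : R3) (v : L2R3) :
    ContinuousOn (fun s => -pairL2 (fun x => heatKernelDt (T + δ - s) (x - c)) v) (Icc 0 T) := by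
  obtain ⟨E, hE, hEb⟩ := exists_gaussian_bound hT hδ c
  have hτ : ∀ s ∈ Icc 0 T, T + δ - s ∈ Icc (δ / 2) (T + 2 * δ) := fun s hs =>
    ⟨by linarith [hs.2], by linarith [hs.1]⟩
  have hτ0 : ∀ s ∈ Icc 0 T, 0 < T + δ - s := fun s hs => by linarith [hs.2]
  refine ContinuousOn.neg ?_
  have : ContinuousOn (fun s => ∫ x, v x * heatKernelDt (T + δ - s) (x - c)) (Icc 0 T) := by
    refine continuousOn_of_dominated (bound := fun x => |v x| * E x) (fun s hs => ?_) (fun s hs => ?_)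
      (integrable_Lp_mul (Lp.memLp v).abs hE) (Filter.Eventually.of_forall fun x => ?_)
    · exact (integrable_Lp_mul (Lp.memLp v) (memLp_heatKernelDt (hτ0 s hs) c)).1
    · refine Filter.Eventually.of_forall fun x => ?_
      rw [norm_mul]
      exact mul_le_mul_of_nonneg_left (hEb _ (hτ s hs) x).2 (norm_nonneg _)
    · refine continuousOn_const.mul ?_
      refine continuousOn_heatKernelDt.comp (f := fun s : ℝ => (T + δ - s, x - c)) (by fun_prop) ?_
      exact fun s hs => ⟨hτ0 s hs, mem_univ _⟩
  exact this.congr fun s hs => pairL2_apply (memLp_heatKernelDt (hτ0 s hs) c) v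

/-- Duality with the backward heat kernel: Gaussian averages of the final state are space-time
averages of the source. -/
theorem IsHeatSolution.integral_mul_heatKernel {F : R3 → ℝ → ℝ} {u : ℝ → L2R3} (hT : 0 ≤ T)
    (hu : IsHeatSolution T F u) (hδ : 0 < δ) (c : R3) :
    ∫ x, u T x * heatKernel δ (x - c) =
      ∫ s in Ioc 0 T, ∫ x, F x s * heatKernel (T + δ - s) (x - c) := by
  obtain ⟨ut, Du, D2u, hreg, hut, hprim, heq⟩ := hu
  obtain ⟨E, hE, hEb⟩ := exists_gaussian_bound hT hδ c
  have hτ : ∀ s ∈ Icc 0 T, T + δ - s ∈ Icc (δ / 2) (T + 2 * δ) := fun s hs =>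
    ⟨by linarith [hs.2], by linarith [hs.1]⟩
  have hτ0 : ∀ s ∈ Icc 0 T, 0 < T + δ - s := fun s hs => by linarith [hs.2]
  have hrestr : volume.restrict (Ioo 0 T) = volume.restrict (Ioc 0 T) :=
    Measure.restrict_congr_set Ioo_ae_eq_Ioc
  have hutint : IntegrableOn ut (Ioc 0 T) := by
    have := hut.integrable one_le_two
    rwa [hrestr] at this
  have hℓcont : ∀ v, ContinuousOn (fun s => pairL2 (fun x => heatKernel (T + δ - s) (x - c)) v)
      (Icc 0 T) := fun v s hs =>
    (hasDerivAt_pairL2_heatKernel hT hδ c v hs).continuousAt.continuousWithinAt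
  have hint : IntegrableOn (fun s => pairL2 (fun x => heatKernel (T + δ - s) (x - c)) (ut s))
      (Ioc 0 T) := by
    refine (hutint.norm.const_mul (eLpNorm E 2 volume).toReal).mono' ?_ ?_
    · -- composition with the projection onto `[0, T]` makes the functionals continuous everywhere
      obtain ⟨w', hw', hww'⟩ := hutint.1
      have hsm := stronglyMeasurable_uncurry_of_continuous_of_stronglyMeasurable
        (u := fun (s : ℝ) (r : ℝ) =>
          pairL2 (fun x => heatKernel (T + δ - projIcc 0 T hT s) (x - c)) (w' r)) (fun r => by
          have := (hℓcont (w' r)).domRestrict.comp (continuous_projIcc (h := hT))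
          exact this) (fun s => (pairL2 _).continuous.comp_stronglyMeasurable hw')
      refine ⟨_, hsm.comp_measurable (measurable_id.prodMk measurable_id), ?_⟩
      filter_upwards [hww', ae_restrict_mem measurableSet_Ioc] with s hs1 hs2
      simp only [Function.comp, Function.uncurry, id]
      rw [projIcc_of_mem hT (Ioc_subset_Icc_self hs2), hs1]
    · filter_upwards [ae_restrict_mem measurableSet_Ioc] with s hs
      have hs' := Ioc_subset_Icc_self hs
      refine (pairL2 _).le_of_opNorm_le ?_ _
      exact norm_pairL2_le (memLp_heatKernel (hτ0 s hs') c) hE fun x => (hEb _ (hτ s hs') x).1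
  have hparts := apply_primitive_eq_integral hT hutint hprim
    (ℓ := fun s => pairL2 (fun x => heatKernel (T + δ - s) (x - c)))
    (ℓ' := fun s => -pairL2 (fun x => heatKernelDt (T + δ - s) (x - c)))
    (N := (eLpNorm E 2 volume).toReal) (fun s hs => by
      rw [norm_neg]
      exact norm_pairL2_le (memLp_heatKernelDt (hτ0 s hs) c) hE fun x => (hEb _ (hτ s hs) x).2)
    (fun v s hs => hasDerivAt_pairL2_heatKernel hT hδ c v hs)
    (fun v => continuousOn_pairL2_heatKernelDt hT hδ c v) hint
  rw [pairL2_apply (memLp_heatKernel (hτ0 T (right_mem_Icc.2 hT)) c)] at hparts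
  simp only [add_sub_cancel_left] at hparts
  rw [hparts]
  refine integral_congr_ae ?_
  have h1 := hreg.fst
  have h2 := hreg.snd
  rw [hrestr] at h1 h2 heq
  filter_upwards [h1, h2, heq, ae_restrict_mem measurableSet_Ioc] with s hs1 hs2 hs3 hs4
  have hs4' := Ioc_subset_Icc_self hs4
  have hK := memLp_heatKernel (hτ0 s hs4') c
  have hlap := integral_laplacian_mul_heatKernel hs1 (fun i => hs2 i i) (hτ0 s hs4') c
  have hi1 := integrable_Lp_mul (Lp.memLp (ut s)) hK
  have hi2 := fun i => integrable_Lp_mul (Lp.memLp (D2u i i s)) hK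
  have hF : ∫ x, F x s * heatKernel (T + δ - s) (x - c) =
      ∫ x, (ut s x * heatKernel (T + δ - s) (x - c) -
        ∑ i, D2u i i s x * heatKernel (T + δ - s) (x - c)) := by
    refine integral_congr_ae ?_
    filter_upwards [hs3] with x hx
    rw [← hx, sub_mul, Finset.sum_mul]
  rw [hF, integral_sub hi1 (integrable_finsetSum _ fun i _ => hi2 i),
    integral_finsetSum _ fun i _ => hi2 i, hlap, ← pairL2_apply hK,
    neg_apply, pairL2_apply (memLp_heatKernelDt (hτ0 s hs4') c)]
  ring

/-- For a moving source, the spatial average may be taken in the frame of the source. -/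
lemma integral_movingSource_mul_heatKernel (f : R3 → ℝ) (a : ℝ → R3) (g : ℝ → ℝ) (s τ : ℝ) (c : R3) :
    ∫ x, movingSource f a g x s * heatKernel τ (x - c) =
      ∫ y, g s * (f y * heatKernel τ (y + a s - c)) := by
  rw [← integral_add_right_eq_self _ (a s)]
  refine integral_congr_ae (Filter.Eventually.of_forall fun y => ?_)
  simp only [movingSource, add_sub_cancel_right]
  ring

end Duality

/-! ### The transform of the heat kernel and Gaussian averages -/

section ApproximateIdentity

lemma measurable_heatKernel : Measurable (fun p : ℝ × R3 => heatKernel p.1 p.2) := by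
  unfold heatKernel
  fun_prop

lemma heatKernel_neg (τ : ℝ) (x : R3) : heatKernel τ (-x) = heatKernel τ x := by
  simp [heatKernel]

/-- The Fourier–Laplace transform of the heat kernel. -/
lemma integral_cexp_mul_heatKernel {τ : ℝ} (hτ : 0 < τ) {e : R3} (he : ‖e‖ = 1) (X : R3) (z : ℂ) :
    Integrable (fun c : R3 => Complex.exp (-Complex.I * z * (inner ℝ e c : ℝ)) *
      (heatKernel τ (X - c) : ℂ)) ∧
    ∫ c : R3, Complex.exp (-Complex.I * z * (inner ℝ e c : ℝ)) * (heatKernel τ (X - c) : ℂ) =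
      Complex.exp (-(τ : ℂ) * z ^ 2 - Complex.I * z * (inner ℝ e X : ℝ)) := by
  set b : ℂ := ((1 / (4 * τ) : ℝ) : ℂ) with hb
  have hbre : 0 < b.re := by rw [hb, Complex.ofReal_re]; positivity
  set A : ℝ := (4 * Real.pi * τ) ^ (-(3 / 2) : ℝ) with hA
  have hpos : (0 : ℝ) < 4 * Real.pi * τ := by positivity
  have hfun : ∀ y : R3, Complex.exp (-Complex.I * z * (inner ℝ e (y + X) : ℝ)) *
      (heatKernel τ (X - (y + X)) : ℂ) = (A * Complex.exp (-Complex.I * z * (inner ℝ e X : ℝ))) *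
        Complex.exp (-b * ‖y‖ ^ 2 + (-Complex.I * z) * (inner ℝ e y : ℝ)) := by
    intro y
    rw [show X - (y + X) = -y by abel, heatKernel_neg, heatKernel, inner_add_right]
    push_cast
    rw [mul_add, Complex.exp_add, Complex.exp_add, hb, ← hA]
    push_cast
    rw [show -(‖y‖ : ℂ) ^ 2 / (4 * τ) = -(1 / (4 * τ)) * (‖y‖ : ℂ) ^ 2 by ring]
    ring
  have hint : Integrable (fun y : R3 => Complex.exp (-Complex.I * z * (inner ℝ e (y + X) : ℝ)) *
      (heatKernel τ (X - (y + X)) : ℂ)) := by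
    simp_rw [hfun]
    exact (GaussianFourier.integrable_cexp_neg_mul_sq_norm_add hbre (-Complex.I * z) e).const_mul _
  constructor
  · have := hint.comp_sub_right X
    simpa using this
  rw [← integral_add_right_eq_self _ X]
  simp_rw [hfun]
  rw [integral_const_mul, GaussianFourier.integral_cexp_neg_mul_sq_norm_add hbre, he]
  have h1 : ((Real.pi : ℂ) / b) ^ ((Module.finrank ℝ R3 : ℂ) / 2) =
      (((4 * Real.pi * τ) ^ ((3 / 2) : ℝ) : ℝ) : ℂ) := by
    rw [finrank_euclideanSpace_fin, Complex.ofReal_cpow hpos.le]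
    congr 1
    · rw [hb]; push_cast; field_simp
    · push_cast; rfl
  have h2 : A * (4 * Real.pi * τ) ^ ((3 / 2) : ℝ) = 1 := by
    rw [hA, ← Real.rpow_add hpos]; norm_num
  have h2' : (A : ℂ) * (((4 * Real.pi * τ) ^ ((3 / 2) : ℝ) : ℝ) : ℂ) = 1 := by
    rw [← Complex.ofReal_mul, h2, Complex.ofReal_one]
  have h3 : (-Complex.I * z) ^ 2 * ((1 : ℝ) : ℂ) ^ 2 / (4 * b) = -(τ : ℂ) * z ^ 2 := by
    have : (τ : ℂ) ≠ 0 := Complex.ofReal_ne_zero.2 hτ.ne'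
    rw [mul_pow, neg_sq, Complex.I_sq, hb]
    push_cast
    field_simp
  rw [h1, h3, sub_eq_add_neg, Complex.exp_add]
  calc _ = ((A : ℂ) * (((4 * Real.pi * τ) ^ ((3 / 2) : ℝ) : ℝ) : ℂ)) *
        (Complex.exp (-(τ : ℂ) * z ^ 2) * Complex.exp (-Complex.I * z * (inner ℝ e X : ℝ))) := by ring
    _ = _ := by rw [h2', one_mul]; ring_nf

lemma exists_unit_R3 : ∃ e : R3, ‖e‖ = 1 := ⟨EuclideanSpace.single 0 1, by simp⟩

lemma integrable_heatKernel {τ : ℝ} (hτ : 0 < τ) : Integrable (heatKernel τ) := by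
  obtain ⟨e, he⟩ := exists_unit_R3
  have h := (integral_cexp_mul_heatKernel hτ he 0 0).1
  have h2 := h.re
  refine h2.congr (Filter.Eventually.of_forall fun x => ?_)
  simp [heatKernel_neg]

lemma integral_heatKernel {τ : ℝ} (hτ : 0 < τ) : ∫ x, heatKernel τ x = 1 := by
  obtain ⟨e, he⟩ := exists_unit_R3
  have h := (integral_cexp_mul_heatKernel hτ he 0 0).2
  simp only [mul_zero, zero_mul, Complex.exp_zero, one_mul, zero_sub, heatKernel_neg, ne_eq,
    OfNat.ofNat_ne_zero, not_false_eq_true, zero_pow, sub_zero, integral_complex_ofReal] at h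
  exact_mod_cast h

/-- Parabolic scaling of the heat kernel. -/
lemma heatKernel_scale {δ : ℝ} (hδ : 0 < δ) (y : R3) :
    heatKernel δ (Real.sqrt δ • y) = (Real.sqrt δ ^ 3)⁻¹ * heatKernel 1 y := by
  have hs : Real.sqrt δ ^ 2 = δ := Real.sq_sqrt hδ.le
  have h1 : (4 * Real.pi * δ) ^ (-(3 / 2) : ℝ) =
      (Real.sqrt δ ^ 3)⁻¹ * (4 * Real.pi * 1) ^ (-(3 / 2) : ℝ) := by
    rw [mul_one, Real.mul_rpow (by positivity) hδ.le, mul_comm]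
    congr 1
    rw [Real.sqrt_eq_rpow, ← Real.rpow_natCast, ← Real.rpow_mul hδ.le, ← Real.rpow_neg hδ.le]
    norm_num
  unfold heatKernel
  rw [h1, norm_smul, Real.norm_of_nonneg (Real.sqrt_nonneg _), mul_pow, hs, mul_assoc]
  congr 3
  field_simp

/-- Gaussian averages of an `L²` function converge weakly to it as the variance tends to zero. -/
lemma tendsto_integral_mul_heatKernel {v ψ : R3 → ℝ} (hvm : Measurable v) (hv : MemLp v 2)
    (hψ : Continuous ψ) (hψc : HasCompactSupport ψ) {δ : ℕ → ℝ} (hδ : ∀ n, 0 < δ n)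
    (hδ0 : Filter.Tendsto δ Filter.atTop (nhds 0)) :
    Filter.Tendsto (fun n => ∫ c, ψ c * ∫ x, v x * heatKernel (δ n) (x - c)) Filter.atTop
      (nhds (∫ c, ψ c * v c)) := by
  have hψ2 : MemLp ψ 2 := hψ.memLp_of_hasCompactSupport hψc
  -- the correlation of `ψ` and `v`
  set G : R3 → ℝ := fun y => ∫ c, ψ c * v (c + y) with hG
  have hvy : ∀ y, MemLp (fun c => v (c + y)) 2 := fun y =>
    hv.comp_measurePreserving (measurePreserving_add_right volume y)
  have hprod : ∀ y, Integrable (fun c => ψ c * v (c + y)) := fun y => integrable_Lp_mul hψ2 (hvy y)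
  have hGc : Continuous G := by
    have h1 := (hψc.comp_homeomorph (Homeomorph.neg R3)).continuous_convolution_left
      (ContinuousLinearMap.mul ℝ ℝ) (μ := volume) (hψ.comp continuous_neg)
      (hv.locallyIntegrable one_le_two)
    convert h1 using 1
    ext y
    rw [convolution_def, ← integral_neg_eq_self]
    simp [hG, add_comm]
  have habs : ∀ y, ∫ c, ‖ψ c * v (c + y)‖ ≤ (∫ c, ψ c ^ 2) + ∫ c, v c ^ 2 := by
    intro y
    have i1 := hψ2.integrable_sq
    have i2 := (hvy y).integrable_sq
    rw [← integral_add_right_eq_self (fun c => v c ^ 2) y, ← integral_add i1 i2]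
    refine integral_mono (hprod y).norm (i1.add i2) fun c => ?_
    rw [Real.norm_eq_abs, abs_mul]
    simp only
    nlinarith [sq_nonneg (|ψ c| - |v (c + y)|), sq_abs (ψ c), sq_abs (v (c + y)),
      sq_nonneg (|ψ c|), sq_nonneg |v (c + y)|]
  set B : ℝ := (∫ c, ψ c ^ 2) + ∫ c, v c ^ 2 with hB
  have hGb : ∀ y, ‖G y‖ ≤ B := fun y => (norm_integral_le_integral_norm _).trans (habs y)
  have hfub : ∀ n, ∫ c, ψ c * ∫ x, v x * heatKernel (δ n) (x - c) =
      ∫ y, heatKernel (δ n) y * G y := by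
    intro n
    have e1 : ∀ c, ψ c * ∫ x, v x * heatKernel (δ n) (x - c) =
        ∫ y, ψ c * v (c + y) * heatKernel (δ n) y := by
      intro c
      rw [← integral_add_right_eq_self _ c, ← integral_const_mul]
      refine integral_congr_ae (Filter.Eventually.of_forall fun y => ?_)
      simp only [add_sub_cancel_right]
      rw [add_comm y c]
      ring
    have hmeas : Measurable (fun p : R3 × R3 => ψ p.1 * v (p.1 + p.2) * heatKernel (δ n) p.2) :=
      ((hψ.measurable.comp measurable_fst).mul (hvm.comp (measurable_fst.add measurable_snd))).mul
        ((continuous_heatKernel _).measurable.comp measurable_snd)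
    have hint : Integrable (fun p : R3 × R3 => ψ p.1 * v (p.1 + p.2) * heatKernel (δ n) p.2)
        (volume.prod volume) := by
      rw [integrable_prod_iff' hmeas.aestronglyMeasurable]
      refine ⟨Filter.Eventually.of_forall fun y => (hprod y).mul_const (heatKernel (δ n) y), ?_⟩
      refine ((integrable_heatKernel (hδ n)).const_mul B).mono'
        (hmeas.aestronglyMeasurable.norm.prod_swap.integral_prod_right') ?_
      refine Filter.Eventually.of_forall fun y => ?_
      have hk := heatKernel_nonneg (hδ n) y
      simp_rw [norm_mul (_ * _)]
      rw [integral_mul_const, norm_mul, norm_norm, Real.norm_of_nonneg hk,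
        Real.norm_of_nonneg (integral_nonneg fun _ => norm_nonneg _)]
      exact mul_le_mul_of_nonneg_right (habs y) hk
    simp_rw [e1]
    rw [integral_integral_swap hint]
    refine integral_congr_ae (Filter.Eventually.of_forall fun y => ?_)
    simp only
    rw [integral_mul_const, mul_comm]
  have hscale : ∀ n, ∫ y, heatKernel (δ n) y * G y =
      ∫ y, heatKernel 1 y * G (Real.sqrt (δ n) • y) := by
    intro n
    have hs : 0 < Real.sqrt (δ n) := Real.sqrt_pos.2 (hδ n)
    have h1 := Measure.integral_comp_smul_of_nonneg volume
      (fun y => heatKernel (δ n) y * G y) (Real.sqrt (δ n)) (hR := hs.le)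
    rw [finrank_euclideanSpace_fin, smul_eq_mul, eq_inv_mul_iff_mul_eq₀ (by positivity),
      ← integral_const_mul] at h1
    rw [← h1]
    refine integral_congr_ae (Filter.Eventually.of_forall fun y => ?_)
    simp only
    rw [heatKernel_scale (hδ n)]
    field_simp
  simp_rw [hfub, hscale]
  have hlim : ∫ c, ψ c * v c = ∫ y, heatKernel 1 y * G 0 := by
    rw [integral_mul_const, integral_heatKernel one_pos, one_mul]
    simp [hG]
  rw [hlim]
  refine tendsto_integral_of_dominated_convergence (fun y => heatKernel 1 y * B) (fun n => ?_)
    ((integrable_heatKernel one_pos).mul_const B) (fun n => ?_) ?_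
  · have := continuous_heatKernel 1
    exact Continuous.aestronglyMeasurable (by fun_prop)
  · refine Filter.Eventually.of_forall fun y => ?_
    rw [norm_mul, Real.norm_of_nonneg (heatKernel_nonneg one_pos y)]
    exact mul_le_mul_of_nonneg_left (hGb _) (heatKernel_nonneg one_pos y)
  · refine Filter.Eventually.of_forall fun y => ?_
    have h1 : Filter.Tendsto (fun n => Real.sqrt (δ n) • y) Filter.atTop (nhds (Real.sqrt 0 • y)) :=
      ((Real.continuous_sqrt.tendsto 0).comp hδ0).smul_const y
    rw [Real.sqrt_zero, zero_smul] at h1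
    exact ((hGc.tendsto 0).comp h1).const_mul _

end ApproximateIdentity

/-! ### Potentials outside a ball -/

section Exterior

/-- The heat kernel as a holomorphic function of the square `q` of the distance. -/
noncomputable def complexHeatKernel (τ : ℝ) (q : ℂ) : ℂ :=
  ((4 * Real.pi * τ) ^ (-(3 / 2) : ℝ) : ℝ) * Complex.exp (-q / (4 * τ))

lemma complexHeatKernel_norm_sq (τ : ℝ) (x : R3) :
    complexHeatKernel τ ((‖x‖ ^ 2 : ℝ) : ℂ) = (heatKernel τ x : ℂ) := by
  unfold complexHeatKernel heatKernel
  push_cast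
  rfl

/-- Uniformly in time, the heat kernel is bounded on the half-plane `Re q ≥ m > 0`. -/
lemma exists_norm_complexHeatKernel_le {m : ℝ} (hm : 0 < m) :
    ∃ B, ∀ τ, 0 < τ → ∀ q : ℂ, m ≤ q.re → ‖complexHeatKernel τ q‖ ≤ B := by
  refine ⟨Real.pi ^ (-(3 / 2) : ℝ) * m ^ (-(3 / 2) : ℝ) * 2, fun τ hτ q hq => ?_⟩
  -- in terms of `y = m / (4 τ)` the bound is a multiple of `y ^ (3 / 2) * exp (-y)`
  set y : ℝ := m / (4 * τ) with hy
  have hy0 : 0 < y := by positivity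
  have hnorm : ‖complexHeatKernel τ q‖ =
      (4 * Real.pi * τ) ^ (-(3 / 2) : ℝ) * Real.exp (-q.re / (4 * τ)) := by
    rw [complexHeatKernel, norm_mul, Complex.norm_real, Complex.norm_exp,
      Real.norm_of_nonneg (by positivity)]
    congr 2
    rw [show (-q / (4 * τ) : ℂ) = -q / ((4 * τ : ℝ) : ℂ) by push_cast; rfl, Complex.div_ofReal_re,
      Complex.neg_re]
  have h1 : Real.exp (-q.re / (4 * τ)) ≤ Real.exp (-y) := by
    rw [Real.exp_le_exp, hy, ← neg_div]
    gcongr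
  have h2 : (4 * Real.pi * τ) ^ (-(3 / 2) : ℝ) =
      Real.pi ^ (-(3 / 2) : ℝ) * m ^ (-(3 / 2) : ℝ) * y ^ (3 / 2 : ℝ) := by
    have e : 4 * Real.pi * τ = Real.pi * m * y⁻¹ := by rw [hy]; field_simp
    rw [e, Real.mul_rpow (by positivity) (by positivity), Real.mul_rpow (by positivity) (by positivity),
      Real.inv_rpow hy0.le, ← Real.rpow_neg hy0.le, neg_neg]
  have h3 : y ^ (3 / 2 : ℝ) * Real.exp (-y) ≤ 2 := by
    have e1 : y ^ (3 / 2 : ℝ) ≤ 1 + y ^ 2 := by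
      rcases le_total y 1 with h | h
      · have := Real.rpow_le_one hy0.le h (show (0 : ℝ) ≤ 3 / 2 by norm_num)
        nlinarith
      · have := Real.rpow_le_rpow_of_exponent_le h (show (3 / 2 : ℝ) ≤ (2 : ℕ) by norm_num)
        rw [Real.rpow_natCast] at this
        linarith
    have e2 := Real.quadratic_le_exp_of_nonneg hy0.le
    rw [Real.exp_neg, ← div_eq_mul_inv, div_le_iff₀ (Real.exp_pos _)]
    nlinarith
  rw [hnorm, h2]
  calc _ ≤ Real.pi ^ (-(3 / 2) : ℝ) * m ^ (-(3 / 2) : ℝ) * y ^ (3 / 2 : ℝ) * Real.exp (-y) := by gcongr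
    _ = Real.pi ^ (-(3 / 2) : ℝ) * m ^ (-(3 / 2) : ℝ) * (y ^ (3 / 2 : ℝ) * Real.exp (-y)) := by ring
    _ ≤ _ := by gcongr

/-- The heat kernel is bounded uniformly in time away from the origin. -/
lemma exists_heatKernel_le {d : ℝ} (hd : 0 < d) :
    ∃ B, ∀ τ, 0 < τ → ∀ x : R3, d ≤ ‖x‖ → ‖heatKernel τ x‖ ≤ B := by
  obtain ⟨B, hB⟩ := exists_norm_complexHeatKernel_le (m := d ^ 2) (by positivity)
  refine ⟨B, fun τ hτ x hx => ?_⟩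
  have := hB τ hτ ((‖x‖ ^ 2 : ℝ) : ℂ) (by rw [Complex.ofReal_re]; gcongr)
  rwa [complexHeatKernel_norm_sq, Complex.norm_real] at this

variable {α : Type*} [MeasurableSpace α] {μ : Measure α} {m : α → ℝ} {σ : α → ℝ}
  {X : α → R3} {ρ : ℝ}

/-- The superposition `∫ m(p) k(σ(p), X(p) - c) dμ(p)` of heat kernels issued by a source with
density `m`, locations `X` and ages `σ`. -/
noncomputable def sourcePotential (μ : Measure α) (m σ : α → ℝ) (X : α → R3) (c : R3) : ℝ :=
  ∫ p, m p * heatKernel (σ p) (X p - c) ∂μ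

lemma dist_lower_bound {x c : R3} {d : ℝ} (hX : ‖x‖ ≤ ρ) (hc : ρ + d ≤ ‖c‖) : d ≤ ‖x - c‖ := by
  have := norm_sub_norm_le c x
  rw [norm_sub_rev]
  linarith

lemma continuousOn_sourcePotential (hm : Integrable m μ) (hσ : Measurable σ) (hX : Measurable X)
    (hσ0 : ∀ᵐ p ∂μ, 0 < σ p) (hXρ : ∀ᵐ p ∂μ, ‖X p‖ ≤ ρ) :
    ContinuousOn (sourcePotential μ m σ X) {c | ρ < ‖c‖} := by
  intro c hc
  refine ContinuousAt.continuousWithinAt ?_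
  obtain ⟨d, hd, hcd⟩ : ∃ d, 0 < d ∧ ρ + d < ‖c‖ := by
    refine ⟨(‖c‖ - ρ) / 2, ?_, ?_⟩ <;> simp only [mem_ofPred_eq] at hc <;> linarith
  obtain ⟨B, hB⟩ := exists_heatKernel_le hd
  have hnhds : ∀ᶠ c' in nhds c, ρ + d < ‖c'‖ := continuous_norm.continuousAt.eventually_const_lt hcd
  refine continuousAt_of_dominated (bound := fun p => ‖m p‖ * B) ?_ ?_ (hm.norm.mul_const B) ?_
  · refine Filter.Eventually.of_forall fun c' => hm.1.mul ?_
    exact (measurable_heatKernel.comp (hσ.prodMk (hX.sub_const c'))).aestronglyMeasurable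
  · filter_upwards [hnhds] with c' hc'
    filter_upwards [hσ0, hXρ] with p h1 h2
    rw [norm_mul]
    exact mul_le_mul_of_nonneg_left (hB _ h1 _ (dist_lower_bound h2 hc'.le)) (norm_nonneg _)
  · refine Filter.Eventually.of_forall fun p => ?_
    have := continuous_heatKernel (σ p)
    exact Continuous.continuousAt (by fun_prop)

/-- If the Gaussian averages of `v` are the potentials of a source in the ball of radius `ρ`, aged by
the variance, then outside that ball `v` itself is the potential of the source. -/
lemma ae_eq_sourcePotential {v : R3 → ℝ} (hvm : Measurable v) (hv : MemLp v 2) (hm : Integrable m μ)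
    (hσ : Measurable σ) (hX : Measurable X) (hσ0 : ∀ᵐ p ∂μ, 0 < σ p) (hXρ : ∀ᵐ p ∂μ, ‖X p‖ ≤ ρ)
    (hdual : ∀ δ, 0 < δ → ∀ c : R3, ∫ x, v x * heatKernel δ (x - c) =
      ∫ p, m p * heatKernel (σ p + δ) (X p - c) ∂μ) :
    ∀ᵐ c : R3, c ∈ {c : R3 | ρ < ‖c‖} → v c = sourcePotential μ m σ X c := by
  have hE : IsOpen {c : R3 | ρ < ‖c‖} := isOpen_lt continuous_const continuous_norm
  have hWc := continuousOn_sourcePotential hm hσ hX hσ0 hXρ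
  have hloc : LocallyIntegrableOn (fun c => v c - sourcePotential μ m σ X c) {c : R3 | ρ < ‖c‖} volume :=
    ((hv.locallyIntegrable one_le_two).locallyIntegrableOn _).sub
      (hWc.locallyIntegrableOn hE.measurableSet)
  have hzero := hE.ae_eq_zero_of_integral_contDiff_smul_eq_zero hloc ?_
  · filter_upwards [hzero] with c hc hc'
    exact sub_eq_zero.1 (hc hc')
  intro ψ hψd hψc hψE
  have hψ := hψd.continuous
  -- the support of the test function stays away from the ball
  obtain ⟨d, hd, hψd'⟩ : ∃ d, 0 < d ∧ ∀ c, ψ c ≠ 0 → ρ + d ≤ ‖c‖ := by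
    rcases (tsupport ψ).eq_empty_or_nonempty with h | h
    · refine ⟨1, one_pos, fun c hc => ?_⟩
      have := subset_tsupport ψ hc
      rw [h] at this
      exact this.elim
    · obtain ⟨c₀, hc₀, hmin⟩ := hψc.isCompact.exists_isMinOn h continuous_norm.continuousOn
      have h1 : ρ < ‖c₀‖ := hψE hc₀
      exact ⟨‖c₀‖ - ρ, by linarith, fun c hc => by
        have := hmin (subset_tsupport ψ hc)
        simp only [mem_ofPred_eq] at this
        linarith⟩
  obtain ⟨B, hB⟩ := exists_heatKernel_le hd
  set δ : ℕ → ℝ := fun n => 1 / ((n : ℝ) + 1) with hδdef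
  have hδ : ∀ n, 0 < δ n := fun n => by positivity
  have hδ0 : Filter.Tendsto δ Filter.atTop (nhds 0) := tendsto_one_div_add_atTop_nhds_zero_nat
  have hleft := tendsto_integral_mul_heatKernel hvm hv hψ hψc hδ hδ0
  have hright : Filter.Tendsto (fun n => ∫ c, ψ c * ∫ x, v x * heatKernel (δ n) (x - c)) Filter.atTop
      (nhds (∫ c, ψ c * sourcePotential μ m σ X c)) := by
    refine tendsto_integral_of_dominated_convergence (fun c => ‖ψ c‖ * ((∫ p, ‖m p‖ ∂μ) * B))
      (fun n => ?_) ((hψ.integrable_of_hasCompactSupport hψc).norm.mul_const _) (fun n => ?_) ?_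
    · have hmeas : Measurable (fun p : R3 × R3 => v p.2 * heatKernel (δ n) (p.2 - p.1)) :=
        (hvm.comp measurable_snd).mul ((continuous_heatKernel _).measurable.comp
          (measurable_snd.sub measurable_fst))
      exact hψ.aestronglyMeasurable.mul hmeas.aestronglyMeasurable.integral_prod_right'
    · refine Filter.Eventually.of_forall fun c => ?_
      rw [norm_mul]
      by_cases hc : ψ c = 0
      · simp [hc]
      refine mul_le_mul_of_nonneg_left ?_ (norm_nonneg _)
      rw [hdual _ (hδ n), ← integral_mul_const]
      refine norm_integral_le_of_norm_le (hm.norm.mul_const B) ?_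
      filter_upwards [hσ0, hXρ] with p h1 h2
      rw [norm_mul]
      exact mul_le_mul_of_nonneg_left (hB _ (add_pos h1 (hδ n)) _
        (dist_lower_bound h2 (hψd' c hc))) (norm_nonneg _)
    · refine Filter.Eventually.of_forall fun c => ?_
      by_cases hc : ψ c = 0
      · simp [hc]
      refine Filter.Tendsto.const_mul _ ?_
      simp_rw [fun n => hdual _ (hδ n) c]
      refine tendsto_integral_of_dominated_convergence (fun p => ‖m p‖ * B) (fun n => ?_)
        (hm.norm.mul_const B) (fun n => ?_) ?_
      · exact hm.1.mul (measurable_heatKernel.comp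
          ((hσ.add_const _).prodMk (hX.sub_const c))).aestronglyMeasurable
      · filter_upwards [hσ0, hXρ] with p h1 h2
        rw [norm_mul]
        exact mul_le_mul_of_nonneg_left (hB _ (add_pos h1 (hδ n)) _
          (dist_lower_bound h2 (hψd' c hc))) (norm_nonneg _)
      · filter_upwards [hσ0] with p h1
        refine Filter.Tendsto.const_mul _ ?_
        have h2 : Filter.Tendsto (fun n => σ p + δ n) Filter.atTop (nhds (σ p)) := by
          simpa using hδ0.const_add (σ p)
        exact ((hasDerivAt_heatKernel h1 (X p - c)).continuousAt.tendsto).comp h2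
  have heq := tendsto_nhds_unique hleft hright
  have hψv : Integrable (fun c => ψ c * v c) :=
    integrable_Lp_mul (hψ.memLp_of_hasCompactSupport hψc) hv
  have hψW : Integrable (fun c => ψ c * sourcePotential μ m σ X c) := by
    have hcont : Continuous (fun c => ψ c * sourcePotential μ m σ X c) := by
      refine continuous_iff_continuousAt.2 fun c => ?_
      by_cases hc : c ∈ tsupport ψ
      · exact hψ.continuousAt.mul (hWc.continuousAt (hE.mem_nhds (hψE hc)))
      · have h0 : ∀ᶠ c' in nhds c, ψ c' * sourcePotential μ m σ X c' = 0 := by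
          filter_upwards [(isClosed_tsupport ψ).isOpen_compl.mem_nhds hc] with c' hc'
          rw [image_eq_zero_of_notMem_tsupport hc', zero_mul]
        exact (continuousAt_const (y := (0 : ℝ))).congr
          (h0.mono fun _ h => h.symm)
    exact hcont.integrable_of_hasCompactSupport hψc.mul_right
  simp_rw [smul_eq_mul, mul_sub]
  rw [integral_sub hψv hψW, heq, sub_self]

/-- The potential is real-analytic along line segments outside the ball: a potential that vanishes near
one point of a small ball vanishes on that ball. -/
lemma sourcePotential_eq_zero_on_ball (hm : Integrable m μ) (hσ : Measurable σ) (hX : Measurable X)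
    (hσ0 : ∀ᵐ p ∂μ, 0 < σ p) (hXρ : ∀ᵐ p ∂μ, ‖X p‖ ≤ ρ) {x x' : R3} {d : ℝ} (hd : 0 < d)
    (hx : ρ + 2 * d ≤ ‖x‖) (hx' : x' ∈ Metric.ball x d)
    (hzero : ∀ᶠ c in nhds x', sourcePotential μ m σ X c = 0) {y : R3} (hy : y ∈ Metric.ball x d) :
    sourcePotential μ m σ X y = 0 := by
  set e : R3 := y - x' with he
  have hen : ‖e‖ < 2 * d := by
    rw [he, ← dist_eq_norm]
    have := dist_triangle_right y x' x
    have := Metric.mem_ball.1 hy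
    have := Metric.mem_ball.1 hx'
    linarith
  -- the square of the distance from `X p` to `x' + z e`, continued to complex `z`
  set q : ℂ → α → ℂ := fun z p => ((‖X p - x'‖ ^ 2 : ℝ) : ℂ) - 2 * z * ((inner ℝ (X p - x') e : ℝ) : ℂ) +
    z ^ 2 * ((‖e‖ ^ 2 : ℝ) : ℂ) with hq
  have hqreal : ∀ (t : ℝ) p, q t p = ((‖X p - (x' + t • e)‖ ^ 2 : ℝ) : ℂ) := by
    intro t p
    have h1 : X p - (x' + t • e) = (X p - x') - t • e := by abel
    rw [h1, norm_sub_sq_real, inner_smul_right, norm_smul, mul_pow, Real.norm_eq_abs, sq_abs, hq]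
    push_cast
    ring
  have hqre : ∀ (z : ℂ) p, (q z p).re = ‖X p - (x' + z.re • e)‖ ^ 2 - z.im ^ 2 * ‖e‖ ^ 2 := by
    intro z p
    have h1 : ‖X p - (x' + z.re • e)‖ ^ 2 = ‖X p - x'‖ ^ 2 - 2 * (z.re * inner ℝ (X p - x') e) +
        z.re ^ 2 * ‖e‖ ^ 2 := by
      have h1 : X p - (x' + z.re • e) = (X p - x') - z.re • e := by abel
      rw [h1, norm_sub_sq_real, inner_smul_right, norm_smul, mul_pow, Real.norm_eq_abs, sq_abs]
    rw [h1, hq]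
    have h2 : (2 * z).re = 2 * z.re := by simp
    have h3 : (z ^ 2).re = z.re ^ 2 - z.im ^ 2 := by simp [sq]
    simp only [Complex.add_re, Complex.sub_re, Complex.ofReal_re, Complex.re_mul_ofReal, h2, h3]
    ring
  -- A complex neighbourhood of the segment from `x'` to `y`. On it the real part of `q` is at least
  -- `d² - (1 / 4)² (2 d)²`, which is positive.
  set D : Set ℂ := {z | x' + z.re • e ∈ Metric.ball x d} ∩ {z | |z.im| < 1 / 4} with hD
  have hDopen : IsOpen D := by
    refine IsOpen.inter ?_ ?_
    · exact Metric.isOpen_ball.preimage (f := fun z : ℂ => x' + z.re • e) (by fun_prop)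
    · exact isOpen_lt (by fun_prop) continuous_const
  have hDconv : Convex ℝ D := by
    refine Convex.inter ?_ ?_
    · intro z hz w hw s t hs ht hst
      simp only [mem_ofPred_eq] at hz hw ⊢
      have := convex_ball x d hz hw hs ht hst
      convert this using 1
      have e1 : x' = s • x' + t • x' := by rw [← add_smul, hst, one_smul]
      nth_rw 1 [e1]
      simp only [Complex.add_re, Complex.smul_re, smul_eq_mul, smul_add, add_smul, mul_smul]
      abel
    · intro z hz w hw s t hs ht hst
      simp only [mem_ofPred_eq, abs_lt] at hz hw ⊢
      simp only [Complex.add_im, Complex.smul_im, smul_eq_mul]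
      constructor
      · rcases eq_or_lt_of_le hs with h | h
        · subst h; simp only [zero_add] at hst; subst hst; linarith
        · nlinarith
      · rcases eq_or_lt_of_le hs with h | h
        · subst h; simp only [zero_add] at hst; subst hst; linarith
        · nlinarith
  have hD0 : (0 : ℂ) ∈ D := by
    refine ⟨?_, ?_⟩
    · simpa using hx'
    · simp
  have hD1 : (1 : ℂ) ∈ D := by
    refine ⟨?_, ?_⟩
    · simpa [he] using hy
    · simp
  have hDq : ∀ z ∈ D, ∀ p, ‖X p‖ ≤ ρ → d ^ 2 / 4 ≤ (q z p).re := by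
    rintro z ⟨h1, h2⟩ p hp
    have h3 : ρ + d ≤ ‖x' + z.re • e‖ := by
      have := Metric.mem_ball.1 h1
      rw [dist_eq_norm] at this
      have h4 := norm_sub_norm_le x (x' + z.re • e)
      rw [norm_sub_rev] at h4
      linarith
    have h4 := dist_lower_bound hp h3
    have h5 : d ^ 2 ≤ ‖X p - (x' + z.re • e)‖ ^ 2 := by gcongr
    have h6 : z.im ^ 2 * ‖e‖ ^ 2 ≤ (1 / 4) ^ 2 * (2 * d) ^ 2 := by
      rw [← sq_abs z.im]
      have h2' : |z.im| ≤ 1 / 4 := le_of_lt h2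
      gcongr
    rw [hqre]
    nlinarith
  obtain ⟨B, hB⟩ := exists_norm_complexHeatKernel_le (m := d ^ 2 / 4) (by positivity)
  have hqm : ∀ z, Measurable (q z) := fun z => by
    rw [hq]
    fun_prop
  set Φ : ℂ → ℂ := fun z => ∫ p, (m p : ℂ) * complexHeatKernel (σ p) (q z p) ∂μ with hΦ
  have hΦd : DifferentiableOn ℂ Φ D := by
    refine differentiableOn_integral_of_dominated hDopen (hm.norm.mul_const B) (fun z _ => ?_)
      (Filter.Eventually.of_forall fun p => ?_) ?_
    · refine (Complex.continuous_ofReal.comp_aestronglyMeasurable hm.1).mul ?_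
      have : Measurable (fun p => complexHeatKernel (σ p) (q z p)) := by
        unfold complexHeatKernel
        have := hqm z
        fun_prop
      exact this.aestronglyMeasurable
    · rw [hq]
      unfold complexHeatKernel
      fun_prop
    · filter_upwards [hσ0, hXρ] with p h1 h2 z hz
      rw [norm_mul, Complex.norm_real]
      exact mul_le_mul_of_nonneg_left (hB _ h1 _ (hDq z hz p h2)) (norm_nonneg _)
  have hΦreal : ∀ t : ℝ, Φ t = (sourcePotential μ m σ X (x' + t • e) : ℂ) := by
    intro t
    rw [hΦ, sourcePotential, ← integral_complex_ofReal]
    refine integral_congr_ae (Filter.Eventually.of_forall fun p => ?_)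
    simp only
    rw [hqreal, complexHeatKernel_norm_sq]
    push_cast
    rfl
  have hfreq : ∃ᶠ z in nhdsWithin (0 : ℂ) {0}ᶜ, Φ z = 0 := by
    have hlim : Filter.Tendsto (fun n : ℕ => ((1 / ((n : ℝ) + 1) : ℝ) : ℂ)) Filter.atTop
        (nhdsWithin (0 : ℂ) {0}ᶜ) := by
      refine tendsto_nhdsWithin_iff.2 ⟨?_, Filter.Eventually.of_forall fun n => ?_⟩
      · exact (Complex.continuous_ofReal.tendsto' 0 0 (by simp)).comp
          tendsto_one_div_add_atTop_nhds_zero_nat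
      · have : (1 / ((n : ℝ) + 1) : ℝ) ≠ 0 := by positivity
        exact Complex.ofReal_ne_zero.2 this
    refine hlim.frequently (Filter.Eventually.frequently ?_)
    have hlim2 : Filter.Tendsto (fun n : ℕ => x' + (1 / ((n : ℝ) + 1) : ℝ) • e) Filter.atTop
        (nhds x') := by
      have := (tendsto_one_div_add_atTop_nhds_zero_nat (𝕜 := ℝ)).smul_const e
      simpa using this.const_add x'
    filter_upwards [hlim2.eventually hzero] with n hn
    rw [hΦreal, hn, Complex.ofReal_zero]
  have hΦan : AnalyticOnNhd ℂ Φ D := hΦd.analyticOnNhd hDopen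
  have h1 := hΦan.eqOn_zero_of_preconnected_of_frequently_eq_zero hDconv.isPreconnected hD0 hfreq hD1
  have h2 := hΦreal 1
  rw [Complex.ofReal_one, one_smul, h1, Pi.zero_apply] at h2
  have h3 : sourcePotential μ m σ X (x' + e) = 0 := by exact_mod_cast h2.symm
  rwa [he, add_sub_cancel] at h3

/-- The exterior of a ball is the image of `(ρ, ∞) × S²` under `(r, w) ↦ r w`. -/
lemma isPreconnected_exterior (hρ : 0 ≤ ρ) : IsPreconnected {c : R3 | ρ < ‖c‖} := by
  have hrank : 1 < Module.rank ℝ R3 := by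
    rw [← Module.finrank_eq_rank, finrank_euclideanSpace_fin]
    norm_num
  have h := ((isPreconnected_Ioi (a := ρ)).prod (isPreconnected_sphere hrank (0 : R3) 1)).image
    (fun p : ℝ × R3 => p.1 • p.2) (by fun_prop)
  convert h using 1
  ext c
  simp only [mem_ofPred_eq, mem_image, mem_prod, mem_Ioi, mem_sphere_iff_norm, sub_zero, Prod.exists]
  constructor
  · intro hc
    have hc0 : ‖c‖ ≠ 0 := by linarith
    exact ⟨‖c‖, ‖c‖⁻¹ • c, ⟨hc, by rw [norm_smul, norm_inv, norm_norm, inv_mul_cancel₀ hc0]⟩,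
      by rw [smul_smul, mul_inv_cancel₀ hc0, one_smul]⟩
  · rintro ⟨r, w, ⟨h1, h2⟩, rfl⟩
    rw [norm_smul, h2, mul_one, Real.norm_of_nonneg (by linarith)]
    exact h1

/-- Unique continuation: a potential that vanishes on a nonempty open set outside the ball vanishes
everywhere outside the ball. -/
lemma sourcePotential_eq_zero (hm : Integrable m μ) (hσ : Measurable σ) (hX : Measurable X)
    (hσ0 : ∀ᵐ p ∂μ, 0 < σ p) (hXρ : ∀ᵐ p ∂μ, ‖X p‖ ≤ ρ) (hρ : 0 ≤ ρ) {U : Set R3} (hU : IsOpen U)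
    (hUne : U.Nonempty) (hUsub : U ⊆ {c | ρ < ‖c‖}) (hzero : ∀ c ∈ U, sourcePotential μ m σ X c = 0)
    {c : R3} (hc : ρ < ‖c‖) : sourcePotential μ m σ X c = 0 := by
  set Z : Set R3 := interior {c | sourcePotential μ m σ X c = 0} with hZ
  have hUZ : U ⊆ Z := interior_maximal hzero hU
  have hsub : {c : R3 | ρ < ‖c‖} ⊆ Z := by
    refine (isPreconnected_exterior hρ).subset_of_closure_inter_subset isOpen_interior ?_ ?_
    · obtain ⟨c, hc⟩ := hUne
      exact ⟨c, hUsub hc, hUZ hc⟩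
    · rintro x ⟨hx1, hx2⟩
      simp only [mem_ofPred_eq] at hx2
      obtain ⟨d, hd, hxd⟩ : ∃ d, 0 < d ∧ ρ + 2 * d ≤ ‖x‖ := ⟨(‖x‖ - ρ) / 2, by linarith, by linarith⟩
      obtain ⟨x', hx'Z, hx'⟩ := Metric.mem_closure_iff.1 hx1 d hd
      have hx'nhds : ∀ᶠ c in nhds x', sourcePotential μ m σ X c = 0 :=
        mem_interior_iff_mem_nhds.1 hx'Z
      rw [hZ, mem_interior_iff_mem_nhds]
      filter_upwards [Metric.ball_mem_nhds x hd] with y hy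
      exact sourcePotential_eq_zero_on_ball hm hσ hX hσ0 hXρ hd hxd
        (by rw [Metric.mem_ball, dist_comm]; exact hx') hx'nhds hy
  have h : c ∈ {c | sourcePotential μ m σ X c = 0} := interior_subset (hsub hc)
  exact h

end Exterior

/-! ### The Fourier–Laplace transform of the final state -/

section FourierLaplace

variable {α : Type*} [MeasurableSpace α] {μ : Measure α} {m : α → ℝ} {σ : α → ℝ} {X : α → R3} {ρ : ℝ}

lemma norm_cexp_neg_I_mul (z : ℂ) (r : ℝ) :
    ‖Complex.exp (-Complex.I * z * (r : ℂ))‖ = Real.exp (z.im * r) := by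
  rw [Complex.norm_exp, Complex.re_mul_ofReal]
  simp

lemma norm_cexp_neg_I_mul_le {z : ℂ} {r : ℝ} (hr : |r| ≤ ρ) :
    ‖Complex.exp (-Complex.I * z * (r : ℂ))‖ ≤ Real.exp (ρ * ‖z‖) := by
  rw [norm_cexp_neg_I_mul, Real.exp_le_exp]
  calc z.im * r ≤ |z.im * r| := le_abs_self _
    _ = |r| * |z.im| := by rw [abs_mul, mul_comm]
    _ ≤ ρ * ‖z‖ := mul_le_mul hr (Complex.abs_im_le_norm z) (abs_nonneg _) ((abs_nonneg r).trans hr)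

/-- The Fourier–Laplace transform `∫ m(p) exp (-i z s(p)) dμ(p)` of the image under `s` of the measure
with density `m`. -/
noncomputable def fourierLaplace (μ : Measure α) (m s : α → ℝ) (z : ℂ) : ℂ :=
  ∫ p, (m p : ℂ) * Complex.exp (-Complex.I * z * (s p : ℂ)) ∂μ

lemma isExpType_fourierLaplace {s : α → ℝ} (hm : Integrable m μ) (hsρ : ∀ᵐ p ∂μ, |s p| ≤ ρ) :
    IsExpType (fourierLaplace μ m s) := by
  refine ⟨∫ p, ‖m p‖ ∂μ, ρ, fun z => ?_⟩
  rw [← integral_mul_const]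
  refine norm_integral_le_of_norm_le (hm.norm.mul_const _) ?_
  filter_upwards [hsρ] with p hp
  rw [norm_mul, Complex.norm_real]
  exact mul_le_mul_of_nonneg_left (norm_cexp_neg_I_mul_le hp) (norm_nonneg _)

lemma differentiable_fourierLaplace {s : α → ℝ} (hm : Integrable m μ) (hs : Measurable s)
    (hsρ : ∀ᵐ p ∂μ, |s p| ≤ ρ) : Differentiable ℂ (fourierLaplace μ m s) := by
  intro z
  have hd : DifferentiableOn ℂ (fourierLaplace μ m s) (Metric.ball 0 (‖z‖ + 1)) := by
    refine differentiableOn_integral_of_dominated Metric.isOpen_ball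
      (bound := fun p => ‖m p‖ * Real.exp (|ρ| * (‖z‖ + 1))) (hm.norm.mul_const _) (fun w _ => ?_)
      (Filter.Eventually.of_forall fun p => by fun_prop) ?_
    · refine (Complex.continuous_ofReal.comp_aestronglyMeasurable hm.1).mul ?_
      exact Measurable.aestronglyMeasurable (by fun_prop)
    · filter_upwards [hsρ] with p hp w hw
      rw [norm_mul, Complex.norm_real]
      refine mul_le_mul_of_nonneg_left
        ((norm_cexp_neg_I_mul_le (hp.trans (le_abs_self ρ))).trans ?_) (norm_nonneg _)
      have := (mem_ball_zero_iff.1 hw).le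
      gcongr
  exact hd.differentiableAt (Metric.isOpen_ball.mem_nhds (by simp))

/-- The exponential moments of the heat kernel. -/
lemma integral_exp_mul_heatKernel {τ : ℝ} (hτ : 0 < τ) {e : R3} (he : ‖e‖ = 1) (x : R3) (y : ℝ) :
    ∫ c : R3, Real.exp (y * inner ℝ e c) * heatKernel τ (x - c) =
      Real.exp (τ * y ^ 2 + y * inner ℝ e x) := by
  have h := (integral_cexp_mul_heatKernel hτ he x (Complex.I * y)).2
  have h1 : ∀ r : ℝ, -Complex.I * (Complex.I * y) * (r : ℂ) = ((y * r : ℝ) : ℂ) := fun r => by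
    rw [← mul_assoc, neg_mul, Complex.I_mul_I]
    push_cast
    ring
  have h2 : -(τ : ℂ) * (Complex.I * y) ^ 2 - Complex.I * (Complex.I * y) * ((inner ℝ e x : ℝ) : ℂ) =
      ((τ * y ^ 2 + y * inner ℝ e x : ℝ) : ℂ) := by
    rw [mul_pow, Complex.I_sq, ← mul_assoc Complex.I Complex.I, Complex.I_mul_I]
    push_cast
    ring
  simp_rw [h1, ← Complex.ofReal_exp, ← Complex.ofReal_mul, integral_complex_ofReal] at h
  rw [h2, ← Complex.ofReal_exp] at h
  exact_mod_cast h

/-- The Fourier–Laplace transform of the potential of a source. -/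
lemma integral_cexp_mul_sourcePotential [SFinite μ] {S : ℝ} (hm : Integrable m μ) (hσ : Measurable σ)
    (hX : Measurable X) (hσ0 : ∀ᵐ p ∂μ, 0 < σ p) (hσS : ∀ᵐ p ∂μ, σ p ≤ S)
    (hXρ : ∀ᵐ p ∂μ, ‖X p‖ ≤ ρ) {e : R3} (he : ‖e‖ = 1) (z : ℂ) :
    ∫ c : R3, Complex.exp (-Complex.I * z * (inner ℝ e c : ℝ)) * (sourcePotential μ m σ X c : ℂ) =
      ∫ p, (m p : ℂ) *
        Complex.exp (-(σ p : ℂ) * z ^ 2 - Complex.I * z * (inner ℝ e (X p) : ℝ)) ∂μ := by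
  -- the interchange of the integrals is justified by the exponential moments of the heat kernel, as
  -- the modulus of the exponential is `exp (Im z ⟪e, c⟫)`
  set H : R3 → α → ℂ := fun c p => (m p : ℂ) * (Complex.exp (-Complex.I * z * (inner ℝ e c : ℝ)) *
    (heatKernel (σ p) (X p - c) : ℂ)) with hH
  have hHn : ∀ p, 0 < σ p → ∀ c, ‖H c p‖ =
      ‖m p‖ * (Real.exp (z.im * inner ℝ e c) * heatKernel (σ p) (X p - c)) := by
    intro p hp c
    rw [hH, norm_mul, norm_mul, norm_cexp_neg_I_mul, Complex.norm_real, Complex.norm_real,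
      Real.norm_of_nonneg (heatKernel_nonneg hp _)]
  have hHm : AEStronglyMeasurable (Function.uncurry H) (volume.prod μ) := by
    have h1 : Measurable (fun q : R3 × α => Complex.exp (-Complex.I * z * (inner ℝ e q.1 : ℝ)) *
        (heatKernel (σ q.2) (X q.2 - q.1) : ℂ)) := by
      have h2 : Measurable (fun q : R3 × α => heatKernel (σ q.2) (X q.2 - q.1)) :=
        measurable_heatKernel.comp ((hσ.comp measurable_snd).prodMk
          ((hX.comp measurable_snd).sub measurable_fst))
      fun_prop
    exact ((Complex.continuous_ofReal.comp_aestronglyMeasurable hm.1).comp_snd).mul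
      h1.aestronglyMeasurable
  have hHi : Integrable (Function.uncurry H) (volume.prod μ) := by
    rw [integrable_prod_iff' hHm]
    constructor
    · filter_upwards [hσ0] with p hp
      exact (integral_cexp_mul_heatKernel hp he (X p) z).1.const_mul (m p : ℂ)
    · refine (hm.norm.mul_const (Real.exp (S * z.im ^ 2 + |z.im| * ρ))).mono'
        hHm.norm.prod_swap.integral_prod_right' ?_
      filter_upwards [hσ0, hσS, hXρ] with p h1 h2 h3
      rw [Real.norm_of_nonneg (integral_nonneg fun _ => norm_nonneg _)]
      simp only [Function.uncurry_apply_pair, hHn p h1]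
      rw [integral_const_mul, integral_exp_mul_heatKernel h1 he]
      have h4 : z.im * inner ℝ e (X p) ≤ |z.im| * ρ := by
        calc z.im * inner ℝ e (X p) ≤ |z.im| * |inner ℝ e (X p)| := by
              rw [← abs_mul]; exact le_abs_self _
          _ ≤ |z.im| * ρ := by
              refine mul_le_mul_of_nonneg_left ?_ (abs_nonneg _)
              have := abs_real_inner_le_norm e (X p)
              rw [he, one_mul] at this
              exact this.trans h3
      gcongr
  have hswap := integral_integral_swap hHi
  have hl : ∀ c, ∫ p, H c p ∂μ = Complex.exp (-Complex.I * z * (inner ℝ e c : ℝ)) *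
      (sourcePotential μ m σ X c : ℂ) := by
    intro c
    rw [sourcePotential, ← integral_complex_ofReal, ← integral_const_mul]
    refine integral_congr_ae (Filter.Eventually.of_forall fun p => ?_)
    simp only [hH]
    push_cast
    ring
  simp_rw [hl] at hswap
  rw [hswap]
  refine integral_congr_ae ?_
  filter_upwards [hσ0] with p hp
  rw [hH, integral_const_mul, (integral_cexp_mul_heatKernel hp he (X p) z).2]

/-- If the Gaussian averages of `v` are the potentials of a source, aged by the variance, and `v`
vanishes outside a ball, then the transform of `v` is the transform of the source in which each point
is weighted with the heat multiplier of its age. -/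
lemma fourierLaplace_eq_integral [SFinite μ] {S : ℝ} {v : R3 → ℝ} (hv : MemLp v 2)
    (hvρ : ∀ᵐ x : R3, ρ < ‖x‖ → v x = 0)
    (hm : Integrable m μ) (hσ : Measurable σ) (hX : Measurable X) (hσ0 : ∀ᵐ p ∂μ, 0 < σ p)
    (hσS : ∀ᵐ p ∂μ, σ p ≤ S) (hXρ : ∀ᵐ p ∂μ, ‖X p‖ ≤ ρ)
    (hdual : ∀ δ, 0 < δ → ∀ c : R3, ∫ x, v x * heatKernel δ (x - c) =
      ∫ p, m p * heatKernel (σ p + δ) (X p - c) ∂μ)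
    {e : R3} (he : ‖e‖ = 1) (z : ℂ) :
    fourierLaplace (volume.restrict (Metric.closedBall 0 ρ)) v (fun x => inner ℝ e x) z =
      ∫ p, (m p : ℂ) *
        Complex.exp (-(σ p : ℂ) * z ^ 2 - Complex.I * z * (inner ℝ e (X p) : ℝ)) ∂μ := by
  set B : Set R3 := Metric.closedBall 0 ρ with hB
  have hvB : ∀ᵐ x : R3, x ∉ B → v x = 0 := by
    filter_upwards [hvρ] with x hx hxB
    exact hx (by simpa [hB] using hxB)
  have hBρ : ∀ᵐ x ∂(volume.restrict B), ‖x‖ ≤ ρ := by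
    filter_upwards [ae_restrict_mem Metric.isClosed_closedBall.measurableSet] with x hx
    simpa [hB] using hx
  have : IsFiniteMeasure (volume.restrict B) := ⟨by
    rw [Measure.restrict_apply_univ]
    exact (isCompact_closedBall (0 : R3) ρ).measure_lt_top⟩
  have hvi : Integrable v (volume.restrict B) := (hv.mono_measure Measure.restrict_le_self).integrable
    one_le_two
  have h1 := integral_cexp_mul_sourcePotential (μ := volume.restrict B) (σ := fun _ => 1) (X := id)
    (S := 1) hvi measurable_const measurable_id (Filter.Eventually.of_forall fun _ => one_pos)
    (Filter.Eventually.of_forall fun _ => le_rfl) hBρ he z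
  have h2 := integral_cexp_mul_sourcePotential (σ := fun p => σ p + 1) (S := S + 1) hm
    (hσ.add_const 1) hX (hσ0.mono fun p hp => by positivity)
    (hσS.mono fun p hp => by linarith) hXρ he z
  have h3 : ∀ c, sourcePotential (volume.restrict B) v (fun _ => 1) id c =
      sourcePotential μ m (fun p => σ p + 1) X c := by
    intro c
    rw [sourcePotential, sourcePotential, ← hdual 1 one_pos c]
    refine setIntegral_eq_integral_of_ae_compl_eq_zero ?_
    filter_upwards [hvB] with x hx hxB
    rw [hx hxB, zero_mul]
  simp_rw [h3] at h1
  rw [h1] at h2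
  -- the averages with `δ = 1` carry the additional factor `exp (-z²)` on both sides
  have hne : Complex.exp (-z ^ 2) ≠ 0 := Complex.exp_ne_zero _
  refine mul_right_cancel₀ hne ?_
  rw [fourierLaplace, ← integral_mul_const, ← integral_mul_const]
  convert h2 using 1
  · refine integral_congr_ae (Filter.Eventually.of_forall fun x => ?_)
    simp only [id]
    rw [mul_assoc, ← Complex.exp_add]
    congr 2
    push_cast
    ring
  · refine integral_congr_ae (Filter.Eventually.of_forall fun p => ?_)
    simp only
    rw [mul_assoc, ← Complex.exp_add]
    congr 2
    push_cast
    ring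

end FourierLaplace

/-! ### Uniqueness of the profile -/

section Uniqueness

/-- Every value of the Fourier transform of `f` is a value of its Fourier–Laplace transform in some
direction. -/
lemma exists_fourierLaplace_eq_charFun (f : R3 → ℝ) (t : R3) :
    ∃ e : R3, ‖e‖ = 1 ∧ ∃ z : ℂ, fourierLaplace volume f (fun y => inner ℝ e y) z =
      ∫ y, (f y : ℂ) * Complex.exp ((inner ℝ y t : ℝ) * Complex.I) := by
  obtain ⟨e, he, hte⟩ : ∃ e : R3, ‖e‖ = 1 ∧ t = ‖t‖ • e := by
    by_cases ht : t = 0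
    · obtain ⟨e, he⟩ := exists_unit_R3
      exact ⟨e, he, by simp [ht]⟩
    · have ht' : ‖t‖ ≠ 0 := norm_ne_zero_iff.2 ht
      exact ⟨‖t‖⁻¹ • t, by rw [norm_smul, norm_inv, norm_norm, inv_mul_cancel₀ ht'],
        by rw [smul_smul, mul_inv_cancel₀ ht', one_smul]⟩
  refine ⟨e, he, -(‖t‖ : ℂ), integral_congr_ae (Filter.Eventually.of_forall fun y => ?_)⟩
  have h : inner ℝ y t = ‖t‖ * inner ℝ e y := by
    conv_lhs => rw [hte, inner_smul_right, real_inner_comm]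
  simp only [h]
  push_cast
  ring_nf

/-- An integrable function whose Fourier transform vanishes is zero: the measures whose densities are
its positive and negative parts have the same characteristic function. -/
lemma ae_eq_zero_of_fourierLaplace_eq_zero {f : R3 → ℝ} (hf : Integrable f)
    (h : ∀ e : R3, ‖e‖ = 1 → ∀ z : ℂ, fourierLaplace volume f (fun y => inner ℝ e y) z = 0) :
    ∀ᵐ y, f y = 0 := by
  have hfp := isFiniteMeasure_withDensity_ofReal hf.2
  have hfn := isFiniteMeasure_withDensity_ofReal hf.neg.2
  have hmp : AEMeasurable (fun y => (f y).toNNReal) := hf.1.aemeasurable.real_toNNReal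
  have hmn : AEMeasurable (fun y => (-f y).toNNReal) := hf.1.aemeasurable.neg.real_toNNReal
  have heq : volume.withDensity (fun y => ENNReal.ofReal (f y)) =
      volume.withDensity (fun y => ENNReal.ofReal ((-f) y)) := by
    refine Measure.ext_of_charFun ?_
    ext t
    obtain ⟨e, he, z, hz⟩ := exists_fourierLaplace_eq_charFun f t
    rw [h e he z] at hz
    have hE : ∀ y, ‖Complex.exp ((inner ℝ y t : ℝ) * Complex.I)‖ ≤ 1 := fun y =>
      (Complex.norm_exp_ofReal_mul_I _).le
    have hEm : AEStronglyMeasurable (fun y : R3 => Complex.exp ((inner ℝ y t : ℝ) * Complex.I)) volume :=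
      Continuous.aestronglyMeasurable (by fun_prop)
    have hi : ∀ w : R3 → ℝ, Integrable w →
        Integrable (fun y => w y * Complex.exp ((inner ℝ y t : ℝ) * Complex.I)) := by
      intro w hw
      refine hw.norm.mono' ((Complex.continuous_ofReal.comp_aestronglyMeasurable hw.1).mul hEm)
        (Filter.Eventually.of_forall fun y => ?_)
      rw [norm_mul, Complex.norm_real]
      exact mul_le_of_le_one_right (norm_nonneg _) (hE y)
    rw [charFun_apply, charFun_apply]
    have e1 := integral_withDensity_eq_integral_smul₀ hmp
      (fun y : R3 => Complex.exp ((inner ℝ y t : ℝ) * Complex.I))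
    have e2 := integral_withDensity_eq_integral_smul₀ hmn
      (fun y : R3 => Complex.exp ((inner ℝ y t : ℝ) * Complex.I))
    refine e1.trans (Eq.trans ?_ e2.symm)
    rw [← sub_eq_zero, hz]
    have ip := hi _ hf.real_toNNReal
    have im := hi _ hf.neg.real_toNNReal
    refine (integral_sub ip im).symm.trans ?_
    refine integral_congr_ae (Filter.Eventually.of_forall fun y => ?_)
    simp only [Real.coe_toNNReal', Pi.neg_apply]
    rw [← sub_mul, ← Complex.ofReal_sub, max_zero_sub_max_neg_zero_eq_self]
  have h2 := (withDensity_eq_iff hf.1.aemeasurable.ennreal_ofReal hf.neg.1.aemeasurable.ennreal_ofReal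
    (by
      have := hfp.measure_univ_lt_top
      rw [withDensity_apply _ MeasurableSet.univ, setLIntegral_univ] at this
      exact this.ne)).1 heq
  filter_upwards [h2] with y hy
  have h3 := congrArg ENNReal.toReal hy
  simp only [Pi.neg_apply, ENNReal.toReal_ofReal'] at h3
  have := max_zero_sub_max_neg_zero_eq_self (f y)
  linarith

lemma heatKernel_le_of_le {δ τ : ℝ} (hδ : 0 < δ) (hτ : δ ≤ τ) (x : R3) :
    heatKernel τ x ≤ (4 * Real.pi * δ) ^ (-(3 / 2) : ℝ) := by
  have hτ0 := hδ.trans_le hτ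
  have h1 : (4 * Real.pi * τ) ^ (-(3 / 2) : ℝ) ≤ (4 * Real.pi * δ) ^ (-(3 / 2) : ℝ) :=
    Real.rpow_le_rpow_of_nonpos (by positivity) (by gcongr) (by norm_num)
  have h2 : Real.exp (-‖x‖ ^ 2 / (4 * τ)) ≤ 1 := by
    rw [Real.exp_le_one_iff, neg_div]
    have : 0 ≤ ‖x‖ ^ 2 / (4 * τ) := by positivity
    linarith
  unfold heatKernel
  calc _ ≤ (4 * Real.pi * τ) ^ (-(3 / 2) : ℝ) * 1 := by gcongr
    _ ≤ _ := by rwa [mul_one]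

/-- Lebesgue measure on the product of the time interval `(0, T)` and the ball `|x| < r` that carries
the profile. -/
noncomputable def sourceMeasure (T r : ℝ) : Measure (ℝ × R3) :=
  (volume.restrict (Ioo 0 T)).prod (volume.restrict (Metric.ball 0 r))

instance instSFiniteSourceMeasure (T r : ℝ) : SFinite (sourceMeasure T r) := by
  unfold sourceMeasure
  infer_instance

lemma ae_sourceMeasure (T r : ℝ) : ∀ᵐ p ∂(sourceMeasure T r), p.1 ∈ Ioo 0 T ∧ ‖p.2‖ < r := by
  rw [sourceMeasure, Measure.prod_restrict]
  filter_upwards [ae_restrict_mem (measurableSet_Ioo.prod measurableSet_ball)] with p hp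
  exact ⟨hp.1, by simpa using hp.2⟩

variable {T r : ℝ} {a : ℝ → R3} {g : ℝ → ℝ} {f : R3 → ℝ}

lemma IsProfile.sub {f₁ f₂ : R3 → ℝ} (h₁ : IsProfile r f₁) (h₂ : IsProfile r f₂) :
    IsProfile r (f₁ - f₂) := by
  refine ⟨h₁.1.sub h₂.1, ?_⟩
  filter_upwards [h₁.2, h₂.2] with x hx₁ hx₂ hx
  rw [Pi.sub_apply, hx₁ hx, hx₂ hx, sub_zero]

lemma IsProfile.integrableOn (hf : IsProfile r f) : IntegrableOn f (Metric.ball 0 r) := by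
  have : IsFiniteMeasure (volume.restrict (Metric.ball (0 : R3) r)) := ⟨by
    rw [Measure.restrict_apply_univ]
    exact measure_ball_lt_top⟩
  exact (hf.1.mono_measure Measure.restrict_le_self).integrable one_le_two

lemma IsProfile.integrable (hf : IsProfile r f) : Integrable f :=
  hf.integrableOn.integrable_of_ae_notMem_eq_zero hf.2

lemma integrable_sourceDensity (hg : Continuous g) (hf : IsProfile r f) :
    Integrable (fun p : ℝ × R3 => g p.1 * f p.2) (sourceMeasure T r) :=
  ((hg.integrableOn_Icc (a := 0) (b := T)).mono_set Ioo_subset_Icc_self).mul_prod hf.integrableOn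

lemma integrable_sourceDensity_mul_heatKernel (hg : Continuous g) (ha : Continuous a)
    (hf : IsProfile r f) {δ : ℝ} (hδ : 0 < δ) (c : R3) :
    Integrable (fun p : ℝ × R3 => g p.1 * f p.2 * heatKernel (T - p.1 + δ) (p.2 + a p.1 - c))
      (sourceMeasure T r) := by
  have hi := integrable_sourceDensity (T := T) hg hf
  refine (hi.norm.mul_const ((4 * Real.pi * δ) ^ (-(3 / 2) : ℝ))).mono' (hi.1.mul ?_) ?_
  · have : Measurable (fun p : ℝ × R3 => heatKernel (T - p.1 + δ) (p.2 + a p.1 - c)) :=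
      measurable_heatKernel.comp (g := fun q : ℝ × R3 => heatKernel q.1 q.2)
        (f := fun p : ℝ × R3 => (T - p.1 + δ, p.2 + a p.1 - c)) (by fun_prop)
    exact this.aestronglyMeasurable
  · filter_upwards [ae_sourceMeasure T r] with p hp
    have h1 : δ ≤ T - p.1 + δ := by linarith [hp.1.2]
    rw [norm_mul, Real.norm_of_nonneg (heatKernel_nonneg (hδ.trans_le h1) _)]
    exact mul_le_mul_of_nonneg_left (heatKernel_le_of_le hδ h1 _) (norm_nonneg _)

/-- Gaussian averages of the final state of the solution with a moving source, as one integral over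
space-time. The orbit and the temporal function may be replaced by continuous functions that agree
with them on `[0, T]`. -/
lemma IsHeatSolution.integral_mul_heatKernel_eq_sourceMeasure (hT : 0 < T) {a₀ : ℝ → R3} {g₀ : ℝ → ℝ}
    (hg : Continuous g) (ha : Continuous a) (hga : ∀ t ∈ Icc 0 T, g₀ t = g t ∧ a₀ t = a t)
    (hf : IsProfile r f) {u : ℝ → L2R3} (hu : IsHeatSolution T (movingSource f a₀ g₀) u) {δ : ℝ}
    (hδ : 0 < δ) (c : R3) :
    ∫ x, u T x * heatKernel δ (x - c) =
      ∫ p, g p.1 * f p.2 * heatKernel (T - p.1 + δ) (p.2 + a p.1 - c) ∂(sourceMeasure T r) := by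
  rw [hu.integral_mul_heatKernel hT.le hδ c, integral_Ioc_eq_integral_Ioo, sourceMeasure,
    integral_prod _ (integrable_sourceDensity_mul_heatKernel hg ha hf hδ c)]
  refine setIntegral_congr_fun measurableSet_Ioo fun s hs => ?_
  obtain ⟨h1, h2⟩ := hga s (Ioo_subset_Icc_self hs)
  simp only
  rw [integral_movingSource_mul_heatKernel, h1, h2, add_sub_right_comm T δ s]
  simp_rw [← mul_assoc]
  refine (setIntegral_eq_integral_of_ae_compl_eq_zero ?_).symm
  filter_upwards [hf.2] with y hy hy'
  rw [hy hy', mul_zero, zero_mul]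

/-- The transform of the source, aged to the final time, factors into the transform of its profile and
the symbol of its motion. -/
lemma integral_sourceMeasure_eq_mul (hf : IsProfile r f) (hT : 0 ≤ T) (e : R3) (z : ℂ) :
    ∫ p, ((g p.1 * f p.2 : ℝ) : ℂ) * Complex.exp (-((T - p.1 : ℝ) : ℂ) * z ^ 2 -
        Complex.I * z * (inner ℝ e (p.2 + a p.1) : ℝ)) ∂(sourceMeasure T r) =
      fourierLaplace volume f (fun y => inner ℝ e y) z *
        sourceSymbol (fun t => g (T - t)) (fun t => inner ℝ e (a (T - t))) T 0 z := by
  have hF : fourierLaplace volume f (fun y => inner ℝ e y) z =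
      ∫ y in Metric.ball 0 r, (f y : ℂ) * Complex.exp (-Complex.I * z * (inner ℝ e y : ℝ)) := by
    refine (setIntegral_eq_integral_of_ae_compl_eq_zero ?_).symm
    filter_upwards [hf.2] with y hy hy'
    rw [hy hy', Complex.ofReal_zero, zero_mul]
  have hG : sourceSymbol (fun t => g (T - t)) (fun t => inner ℝ e (a (T - t))) T 0 z =
      ∫ s in Ioo 0 T, Complex.exp (-((T - s : ℝ) : ℂ) * z ^ 2 -
        Complex.I * z * (inner ℝ e (a s) : ℝ)) * (g s : ℂ) := by
    have h := intervalIntegral.integral_comp_sub_left (a := 0) (b := T)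
      (fun s => Complex.exp (-((T - s : ℝ) : ℂ) * z ^ 2 -
        Complex.I * z * (inner ℝ e (a s) : ℝ)) * (g s : ℂ)) T
    rw [sub_self, sub_zero, intervalIntegral.integral_of_le hT, intervalIntegral.integral_of_le hT] at h
    rw [sourceSymbol, intervalIntegral.integral_of_le hT, ← integral_Ioc_eq_integral_Ioo, ← h]
    simp only [sub_sub_cancel, sub_zero]
  rw [hF, hG, mul_comm (∫ y in Metric.ball 0 r, _), ← integral_prod_mul, sourceMeasure]
  refine integral_congr_ae (Filter.Eventually.of_forall fun p => ?_)
  simp only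
  rw [inner_add_right]
  push_cast
  rw [show -((T : ℂ) - p.1) * z ^ 2 - Complex.I * z * (inner ℝ e p.2 + inner ℝ e (a p.1)) =
    (-((T : ℂ) - p.1) * z ^ 2 - Complex.I * z * inner ℝ e (a p.1)) +
      -Complex.I * z * inner ℝ e p.2 by ring, Complex.exp_add]
  ring

end Uniqueness

theorem mainTheorem1
    (R R₁ R₂ T : ℝ) (hR : R₁ + R₂ < R) (hT : 0 < T)
    -- the known orbit: `a ∈ C¹[0, ∞)` and `|a(t)| < R₂`
    (a : ℝ → R3) (ha : ContDiffOn ℝ 1 a (Ici 0)) (ha_bdd : ∀ t, 0 ≤ t → ‖a t‖ < R₂)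
    -- the known temporal function: bounded and continuous on `[0, ∞)`, active before time `T`
    (g : ℝ → ℝ) (hg : ContinuousOn g (Ici 0)) (hg_bdd : ∃ M : ℝ, ∀ t, 0 ≤ t → |g t| ≤ M)
    (hg_ne : ∃ t ∈ Icc 0 T, g t ≠ 0)
    -- the measurement domain
    (Ω : Set R3) (hΩ_open : IsOpen Ω) (hΩ_conn : IsConnected Ω)
    (hΩ_bdd : Bornology.IsBounded Ω) (hΩ : (Ω ∩ (Metric.ball (0 : R3) R)ᶜ).Nonempty)
    -- two profiles with the corresponding solutions
    (f₁ f₂ : R3 → ℝ) (hf₁ : IsProfile R₁ f₁) (hf₂ : IsProfile R₁ f₂)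
    (u₁ u₂ : ℝ → L2R3)
    (hu₁ : IsHeatSolution T (movingSource f₁ a g) u₁)
    (hu₂ : IsHeatSolution T (movingSource f₂ a g) u₂)
    -- equal final data on `Ω`
    (hfinal : ∀ᵐ x ∂(volume.restrict Ω), u₁ T x = u₂ T x) :
    ∀ᵐ x : R3, f₁ x = f₂ x := by
  have hf : IsProfile R₁ (f₁ - f₂) := hf₁.sub hf₂
  suffices h : ∀ᵐ x : R3, (f₁ - f₂) x = 0 by
    filter_upwards [h] with x hx using sub_eq_zero.1 hx
  rcases le_or_gt R₁ 0 with hR₁ | hR₁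
  · filter_upwards [hf.2] with x hx
    exact hx (by simp [Metric.ball_eq_empty.2 hR₁])
  have hR₂ : 0 < R₂ := (norm_nonneg _).trans_lt (ha_bdd 0 le_rfl)
  -- continuous extensions of the orbit and of the temporal function to the whole line
  set a' : ℝ → R3 := fun t => a (max t 0) with ha'
  set g' : ℝ → ℝ := fun t => g (max t 0) with hg'
  have ha'c : Continuous a' := ha.continuousOn.comp_continuous (by fun_prop) fun t => le_max_right t 0
  have hg'c : Continuous g' := hg.comp_continuous (by fun_prop) fun t => le_max_right t 0
  have hext : ∀ t ∈ Icc 0 T, g t = g' t ∧ a t = a' t := fun t ht => by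
    simp only [hg', ha', max_eq_left ht.1, and_self]
  set m : ℝ × R3 → ℝ := fun p => g' p.1 * (f₁ - f₂) p.2 with hm
  set σ : ℝ × R3 → ℝ := fun p => T - p.1 with hσ
  set X : ℝ × R3 → R3 := fun p => p.2 + a' p.1 with hX
  have hmi : Integrable m (sourceMeasure T R₁) := integrable_sourceDensity hg'c hf
  have hσm : Measurable σ := by fun_prop
  have hXm : Measurable X := by fun_prop
  have hσ0 : ∀ᵐ p ∂(sourceMeasure T R₁), 0 < σ p := by
    filter_upwards [ae_sourceMeasure T R₁] with p hp
    exact sub_pos.2 hp.1.2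
  have hσT : ∀ᵐ p ∂(sourceMeasure T R₁), σ p ≤ T := by
    filter_upwards [ae_sourceMeasure T R₁] with p hp
    exact sub_le_self _ hp.1.1.le
  have hXρ : ∀ᵐ p ∂(sourceMeasure T R₁), ‖X p‖ ≤ R₁ + R₂ := by
    filter_upwards [ae_sourceMeasure T R₁] with p hp
    exact (norm_add_le _ _).trans (add_le_add hp.2.le (ha_bdd _ (le_max_right _ _)).le)
  set v : L2R3 := u₁ T - u₂ T with hv
  have hvae : ∀ᵐ x, v x = u₁ T x - u₂ T x := Lp.coeFn_sub (u₁ T) (u₂ T)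
  have hvm : Measurable v := (Lp.stronglyMeasurable v).measurable
  have hdual : ∀ δ, 0 < δ → ∀ c : R3, ∫ x, v x * heatKernel δ (x - c) =
      ∫ p, m p * heatKernel (σ p + δ) (X p - c) ∂(sourceMeasure T R₁) := by
    intro δ hδ c
    have hk := memLp_heatKernel hδ c
    have e1 : ∫ x, v x * heatKernel δ (x - c) =
        ∫ x, (u₁ T x * heatKernel δ (x - c) - u₂ T x * heatKernel δ (x - c)) := by
      refine integral_congr_ae ?_
      filter_upwards [hvae] with x hx
      rw [hx, sub_mul]
    rw [e1, integral_sub (integrable_Lp_mul (Lp.memLp _) hk) (integrable_Lp_mul (Lp.memLp _) hk),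
      hu₁.integral_mul_heatKernel_eq_sourceMeasure hT hg'c ha'c hext hf₁ hδ c,
      hu₂.integral_mul_heatKernel_eq_sourceMeasure hT hg'c ha'c hext hf₂ hδ c,
      ← integral_sub (integrable_sourceDensity_mul_heatKernel hg'c ha'c hf₁ hδ c)
        (integrable_sourceDensity_mul_heatKernel hg'c ha'c hf₂ hδ c)]
    refine integral_congr_ae (Filter.Eventually.of_forall fun p => ?_)
    simp only [hm, hσ, hX, Pi.sub_apply]
    ring
  have hvW := ae_eq_sourcePotential hvm (Lp.memLp v) hmi hσm hXm hσ0 hXρ hdual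
  have hWc := continuousOn_sourcePotential hmi hσm hXm hσ0 hXρ
  -- the part of `Ω` outside the ball that contains the source at all times
  set U : Set R3 := Ω ∩ {c | R₁ + R₂ < ‖c‖} with hU
  have hUo : IsOpen U := hΩ_open.inter (isOpen_lt continuous_const continuous_norm)
  have hUne : U.Nonempty := by
    obtain ⟨x, hx1, hx2⟩ := hΩ
    refine ⟨x, hx1, ?_⟩
    have : R ≤ ‖x‖ := by simpa using hx2
    exact hR.trans_le this
  have hWU : EqOn (sourcePotential (sourceMeasure T R₁) m σ X) (fun _ => 0) U := by
    refine Measure.eqOn_open_of_ae_eq (μ := volume) ?_ hUo (hWc.mono inter_subset_right)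
      continuousOn_const
    rw [ae_restrict_iff' hΩ_open.measurableSet] at hfinal
    rw [Filter.EventuallyEq, ae_restrict_iff' hUo.measurableSet]
    filter_upwards [hfinal, hvW, hvae] with c h1 h2 h3 hc
    rw [← h2 hc.2, h3, h1 hc.1, sub_self]
  have hvρ : ∀ᵐ x : R3, R₁ + R₂ < ‖x‖ → v x = 0 := by
    filter_upwards [hvW] with c h1 hc
    rw [h1 hc]
    exact sourcePotential_eq_zero hmi hσm hXm hσ0 hXρ (by positivity) hUo hUne inter_subset_right
      hWU hc
  -- if the transform `F` of the profile did not vanish in the direction `e`, the symbol of the motion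
  -- would be the quotient `V / F` of functions of exponential type
  refine ae_eq_zero_of_fourierLaplace_eq_zero hf.integrable fun e he z₁ => ?_
  by_contra hne
  set h : ℝ → ℝ := fun t => g' (T - t) with hh
  set b : ℝ → ℝ := fun t => inner ℝ e (a' (T - t)) with hb
  have hhc : Continuous h := by fun_prop
  have hbc : Continuous b := by fun_prop
  have hinner : ∀ x : R3, |inner ℝ e x| ≤ ‖x‖ := fun x => by
    simpa [he] using abs_real_inner_le_norm e x
  have hinm : Measurable (fun x : R3 => (inner ℝ e x : ℝ)) := by fun_prop
  set V : ℂ → ℂ := fourierLaplace (volume.restrict (Metric.closedBall 0 (R₁ + R₂))) v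
    (fun x => inner ℝ e x) with hV
  set F : ℂ → ℂ := fourierLaplace volume (f₁ - f₂) (fun y => inner ℝ e y) with hF
  have hfac : ∀ z, V z = F z * sourceSymbol h b T 0 z := fun z =>
    (fourierLaplace_eq_integral (Lp.memLp v) hvρ hmi hσm hXm hσ0 hσT hXρ hdual he z).trans
      (integral_sourceMeasure_eq_mul hf hT.le e z)
  have hVe : IsExpType V := by
    have : IsFiniteMeasure (volume.restrict (Metric.closedBall (0 : R3) (R₁ + R₂))) := ⟨by
      rw [Measure.restrict_apply_univ]
      exact measure_closedBall_lt_top⟩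
    refine isExpType_fourierLaplace (ρ := R₁ + R₂)
      (((Lp.memLp v).mono_measure Measure.restrict_le_self).integrable one_le_two) ?_
    filter_upwards [ae_restrict_mem measurableSet_closedBall] with x hx
    exact (hinner x).trans (by simpa using hx)
  have hFr : F = fourierLaplace (volume.restrict (Metric.ball 0 R₁)) (f₁ - f₂)
      (fun y => inner ℝ e y) := by
    ext z
    refine (setIntegral_eq_integral_of_ae_compl_eq_zero ?_).symm
    filter_upwards [hf.2] with y hy hy'
    rw [hy hy', Complex.ofReal_zero, zero_mul]
  have hin : ∀ᵐ y ∂(volume.restrict (Metric.ball (0 : R3) R₁)), |inner ℝ e y| ≤ R₁ := by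
    filter_upwards [ae_restrict_mem measurableSet_ball] with y hy
    exact (hinner y).trans (mem_ball_zero_iff.1 hy).le
  have hFd : Differentiable ℂ F := by
    rw [hFr]
    exact differentiable_fourierLaplace hf.integrableOn hinm hin
  have hFe : IsExpType F := by
    rw [hFr]
    exact isExpType_fourierLaplace hf.integrableOn hin
  have hGe : IsExpType (sourceSymbol h b T 0) :=
    IsExpType.of_mul hFd (differentiable_sourceSymbol hhc hbc hT.le) hfac hFe hVe hne
  have hzero := eq_zero_of_isExpType_sourceSymbol hhc hbc hT hGe
  obtain ⟨t, ht, hgt⟩ := hg_ne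
  refine hgt ?_
  have := hzero (T - t) ⟨by linarith [ht.2], by linarith [ht.1]⟩
  rw [(hext t ht).1]
  simpa [hh] using this
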